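/- \textbf{Theorem (Robust SFRL).} Let $\mathcal X$ and $\mathcal Y$ be Polish spaces with their Borel $\sigma$-algebras, $\mathcal Y\neq\emptyset$, let $\mathcal S$ be a finite set of probability measures on $\mathcal X$, and let $Q=Q_{Y|X}$ be a conditional distribution (Markov kernel) from $\mathcal X$ to $\mathcal Y$. Logarithms are to base $2$, and information quantities are in bits. For $\mu\in\mathcal S$ let $q_\mu$ be the second marginal of $\mu\otimes Q$, put $I(\mu,Q)=D_{\mathrm{KL}}(\mu\otimes Q\,\|\,\mu\times q_\mu)$, assume $I(\mu,Q)<\infty$ for every $\mu\in\mathcal S$, and put $\bar I=\bar I(\mathcal S,Q)=\sup_{\mu\in\mathcal S}I(\mu,Q)$. Then there exist a random variable $Z$ with values in a standard Borel space $\mathcal Z$ and a measurable function $g:\mathcal X\times\mathcal Z\to\mathcal Y$, neither depending on $\mu$, such that $Z$ can be defined on one probability space together with pairs $(X_\mu,Y_\mu)\sim\mu\otimes Q$, $\mu\in\mathcal S$, for which, for every $\mu\in\mathcal S$, \begin{enumerate} \item[(a)] $Z$ is independent of $X_\mu$; \item[(b)] $Y_\mu=g(X_\mu,Z)$ almost surely;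 \item[(c)] $H(Y_\mu\mid Z)\le \bar I+\log\bigl(|\mathcal S|\,(\bar I+1)\bigr)+4$. \end{enumerate} Moreover, for every $\mu\in\mathcal S$ and every pair of random variables $(X,Y)\sim\mu\otimes Q$ on any probability space, there are an extension of that probability space and a random variable on it with the same law as $Z$ such that (a)--(c) hold, with the same $g$, for $(X,Y)$ and this copy of $Z$. Here $H(Y\mid Z)$ is the average over $z\sim P_Z$ of the Shannon entropy of the conditional law of $Y$ given $Z=z$, where the entropy of a probability measure $\rho$ is $-\sum_y\rho\{y\}\log\rho\{y\}$ if $\rho$ is concentrated on a countable set, and $\infty$ otherwise. -/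

import Mathlib

open MeasureTheory ProbabilityTheory
open scoped ENNReal

universe u v w

namespace RobustSFRL

/-- The mutual information `I(μ, Q) = D(μ ⊗ Q ‖ μ × q)` in bits, where `q` is the output marginal
of `μ ⊗ Q`. -/
noncomputable def mutualInfo {𝒳 : Type u} {𝒴 : Type v} [MeasurableSpace 𝒳] [MeasurableSpace 𝒴]
    (μ : ProbabilityMeasure 𝒳) (Q : Kernel 𝒳 𝒴) : ℝ≥0∞ :=
  InformationTheory.klDiv ((μ : Measure 𝒳) ⊗ₘ Q)
      ((μ : Measure 𝒳).prod ((μ : Measure 𝒳) ⊗ₘ Q).snd)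
    / ENNReal.ofReal (Real.log 2)

/-- `Ī(S, Q) = sup_{μ ∈ S} I(μ, Q)`, in bits. -/
noncomputable def maxMutualInfo {𝒳 : Type u} {𝒴 : Type v} [MeasurableSpace 𝒳] [MeasurableSpace 𝒴]
    (S : Finset (ProbabilityMeasure 𝒳)) (Q : Kernel 𝒳 𝒴) : ℝ≥0∞ :=
  ⨆ μ ∈ S, mutualInfo μ Q

/-- The Shannon entropy, in bits, of a probability measure `ρ` on a standard Borel space:
`E[- log ρ{Y}]` for `Y ∼ ρ`, where `- log 0 = ∞`. It is `∑ y, - ρ{y} log ρ{y}` if `ρ` is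
concentrated on a countable set, and `∞` otherwise. -/
noncomputable def entropy {𝒴 : Type v} [MeasurableSpace 𝒴] (ρ : Measure 𝒴) : ℝ≥0∞ :=
  (∫⁻ y, (-(ENNReal.log (ρ {y}))).toENNReal ∂ρ) / ENNReal.ofReal (Real.log 2)

/-- The conditional entropy `H(Y | Z)`, in bits: the average over `z ∼ P_Z` of the entropy of the
conditional law of `Y` given `Z = z`. -/
noncomputable def condEntropy {Ω : Type u} {𝒴 : Type v} {𝒵 : Type w}
    [MeasurableSpace Ω] [MeasurableSpace 𝒴] [StandardBorelSpace 𝒴] [Nonempty 𝒴]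
    [MeasurableSpace 𝒵] (P : Measure Ω) [IsFiniteMeasure P] (Y : Ω → 𝒴) (Z : Ω → 𝒵) : ℝ≥0∞ :=
  ∫⁻ z, entropy (condDistrib Y Z P z) ∂(P.map Z)

end RobustSFRL

/-!
The proof is the Poisson functional representation, with one Poisson process for all sources.

Let `q` be a probability measure that dominates all output marginals `q_μ`, and let `f x` be the
density of `Q x` with respect to `q`. The variable `Z` is a Poisson process of points `(t, u)` on
`(0, ∞) × 𝒴` with intensity `dt × q`, and `g (x, Z)` is the coordinate `u` of the point that
minimizes the score `t / f x u` (`select`). The points of score at most `s` have intensity `s`, so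
the smallest score is exponential, and by Mecke's formula the first point has density
`exp (- t / f x u)` with respect to `dt × q` (`tsum_setLIntegral_isFirst_score`). Integrating out
`t` gives `g (x, Z) ∼ Q x` (`map_select`). Neither `Z` nor `g` depends on `μ`.

The process is built as a superposition of independent slabs `(n, n + 1] × 𝒴`, each with a Poisson
number of i.i.d. points. Mecke's formula then follows by resampling a single entry, which leaves the
product measure unchanged. It is enough to prove it as a lower bound for the law of the first point,
since the density has total mass one (`tsum_setLIntegral_isFirst`).

For the entropy, fix `μ` and give every point `(t, u)` of the process the weight
`exp (- cost) = ε (1 + t / w u) ^ (-(1 + ε))`, where `w` is the density of `(q_μ + q) / 2`. By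
Campbell's formula the weights have expected sum `∫ w dq = 1`, so Gibbs' inequality bounds
`H(Y | Z)`, in nats, by the expected cost of the selected point (`lintegral_neg_log_kernel_le`),
which is `-log ε + (1 + ε) E[log (1 + t / w u)]`. Jensen's inequality for the exponential time `t`
of mean `f x u` replaces `t` by `f x u`, and the Donsker–Varadhan inequality gives
`E[log (1 + f X Y / w Y)] ≤ I(μ, Q) + log 3`, since `∫ (1 + f / w) d(μ × q_μ) ≤ 3`. The reference
measure `q` has dropped out, so that no price is paid for serving all of `S`. With
`ε = 1 / (I + 1)` the bound in bits is `I + log (I + 1) + 2 log 3`, and `2 log 3 ≤ 4`.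

A given pair `(X, Y)` is extended by drawing `Z` from its conditional law given the pair.
-/

namespace RobustSFRL
open scoped NNReal

/-! ### Poisson processes on a union of slabs -/

section

/-- Resampling one coordinate of a product measure independently leaves the measure unchanged. -/
lemma measurePreserving_update_infinitePi {ι : Type*} [DecidableEq ι] {X : ι → Type*}
    [∀ i, MeasurableSpace (X i)] (μ : ∀ i, Measure (X i)) [∀ i, IsProbabilityMeasure (μ i)]
    (i : ι) :
    MeasurePreserving (fun p : X i × (∀ j, X j) => Function.update p.2 i p.1)
      ((μ i).prod (Measure.infinitePi μ)) (Measure.infinitePi μ) := by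
  have hm : Measurable (fun p : X i × (∀ j, X j) => Function.update p.2 i p.1) := by
    refine measurable_pi_lambda _ fun j => ?_
    by_cases h : j = i
    · subst h; simpa using measurable_fst
    · simpa [Function.update_of_ne h, Function.comp_def] using
        (measurable_pi_apply j).comp (measurable_snd (α := X i))
  refine ⟨hm, Measure.eq_infinitePi _ fun s t ht => ?_⟩
  rw [Measure.map_apply hm (.pi s.countable_toSet fun j _ => ht j)]
  have hpre : (fun p : X i × (∀ j, X j) => Function.update p.2 i p.1) ⁻¹' (s : Set ι).pi t =
      (if i ∈ s then t i else Set.univ) ×ˢ ((s.erase i : Finset ι) : Set ι).pi t := by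
    ext p
    simp only [Set.mem_preimage, Set.mem_pi, Set.mem_prod, Finset.coe_erase, Set.mem_sdiff,
      Set.mem_singleton_iff, Finset.mem_coe]
    constructor
    · intro h
      refine ⟨?_, fun j hj => by simpa [Function.update_of_ne hj.2] using h j hj.1⟩
      split_ifs with hi
      · simpa using h i hi
      · trivial
    · rintro ⟨h1, h2⟩ j hj
      by_cases hji : j = i
      · subst hji; simpa [hj] using h1
      · simpa [Function.update_of_ne hji] using h2 j ⟨hj, hji⟩
  rw [hpre, Measure.prod_prod, Measure.infinitePi_pi _ fun j _ => ht j]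
  split_ifs with hi
  · exact Finset.mul_prod_erase s (fun j => μ j (t j)) hi
  · rw [measure_univ, one_mul, Finset.erase_eq_of_notMem hi]

/-- The Mecke formula for a Poisson variable of rate one. -/
lemma tsum_lintegral_poissonMeasure_pred (ψ : ℕ → ℝ≥0∞) :
    ∑' i, ∫⁻ k, (if i < k then ψ (k - 1) else 0) ∂(poissonMeasure 1) =
      ∫⁻ k, ψ k ∂(poissonMeasure 1) := by
  simp_rw [lintegral_countable']
  rw [ENNReal.tsum_comm]
  have hk : ∀ k : ℕ, ∑' i : ℕ, (if i < k then ψ (k - 1) else 0) * poissonMeasure 1 {k} =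
      k * (ψ (k - 1) * poissonMeasure 1 {k}) := by
    intro k
    rw [tsum_eq_sum (s := Finset.range k) (by intro i hi; simp at hi; simp [hi])]
    rw [Finset.sum_congr rfl (g := fun _ => ψ (k - 1) * poissonMeasure 1 {k})
      (by intro i hi; simp at hi; simp [hi])]
    simp
  simp_rw [hk]
  rw [tsum_eq_zero_add' ENNReal.summable]
  simp only [Nat.cast_zero, zero_mul, zero_add, Nat.add_sub_cancel]
  congr 1 with k
  have : ((k + 1 : ℕ) : ℝ≥0∞) * poissonMeasure 1 {k + 1} = poissonMeasure 1 {k} := by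
    rw [poissonMeasure_singleton, poissonMeasure_singleton, ← ENNReal.ofReal_natCast,
      ← ENNReal.ofReal_mul (by positivity)]
    congr 1
    have : ((k.factorial : ℕ) : ℝ) ≠ 0 := by positivity
    rw [Nat.factorial_succ]
    push_cast
    field_simp
    simp
  rw [← this]; ring

/-- The generating function of a Poisson variable of rate one. -/
lemma lintegral_pow_poissonMeasure {p : ℝ} (hp : p ≤ 1) :
    ∫⁻ k, ENNReal.ofReal (1 - p) ^ k ∂(poissonMeasure 1) = ENNReal.ofReal (Real.exp (-p)) := by
  have h0 : 0 ≤ 1 - p := by linarith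
  have hs : HasSum (fun k : ℕ => (1 - p) ^ k * (Real.exp (-1) * 1 ^ k / k.factorial))
      (Real.exp (-p)) := by
    have := (NormedSpace.expSeries_div_hasSum_exp (1 - p : ℝ)).mul_left (Real.exp (-1))
    rw [← Real.exp_eq_exp_ℝ, ← Real.exp_add] at this
    convert! this using 1
    · ext k; simp; ring
    · ring_nf
  rw [lintegral_countable', ← hs.tsum_eq, ENNReal.ofReal_tsum_of_nonneg (fun k => by positivity)
    hs.summable]
  congr 1 with k
  rw [poissonMeasure_singleton, ENNReal.ofReal_mul (by positivity), ENNReal.ofReal_pow h0]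
  simp

variable {E : Type*}

/-- The entry with label `a = (n, i)`: number `i` in slab `n`. -/
def point (z : ℕ → ℕ × (ℕ → E)) (a : ℕ × ℕ) : E := (z a.1).2 a.2

/-- The entry with label `a` is a point of the process. -/
def Active (z : ℕ → ℕ × (ℕ → E)) (a : ℕ × ℕ) : Prop := a.2 < (z a.1).1

/-- Among the points of the process, the one with label `a` has strictly the smallest score. -/
def IsFirst (score : E → ℝ≥0∞) (z : ℕ → ℕ × (ℕ → E)) (a : ℕ × ℕ) : Prop :=
  Active z a ∧ ∀ b, b ≠ a → Active z b → score (point z a) < score (point z b)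

lemma IsFirst.unique {score : E → ℝ≥0∞} {z : ℕ → ℕ × (ℕ → E)} {a b : ℕ × ℕ}
    (ha : IsFirst score z a) (hb : IsFirst score z b) : a = b := by
  by_contra h
  exact lt_asymm (ha.2 b (Ne.symm h) hb.1) (hb.2 a h ha.1)

variable [MeasurableSpace E]

/-- The law of the points in one slab: a number `N` of points that is Poisson of rate one,
together with an i.i.d. sequence, of which only the first `N` entries are points of the process. -/
noncomputable def slabLaw (ν : Measure E) : Measure (ℕ × (ℕ → E)) :=
  (poissonMeasure 1).prod (Measure.infinitePi fun _ => ν)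

instance (ν : Measure E) [IsProbabilityMeasure ν] : IsProbabilityMeasure (slabLaw ν) := by
  unfold slabLaw; infer_instance

/-- The law of a Poisson process with intensity `∑ n, ν n`, as the superposition of independent
processes with the intensities `ν n`. -/
noncomputable def poissonLaw (ν : ℕ → Measure E) : Measure (ℕ → ℕ × (ℕ → E)) :=
  Measure.infinitePi fun n => slabLaw (ν n)

instance (ν : ℕ → Measure E) [∀ n, IsProbabilityMeasure (ν n)] :
    IsProbabilityMeasure (poissonLaw ν) := by
  unfold poissonLaw; infer_instance

lemma measurable_point (a : ℕ × ℕ) :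
    Measurable fun z : ℕ → ℕ × (ℕ → E) => point z a :=
  (measurable_pi_apply a.2).comp (measurable_snd.comp (measurable_pi_apply a.1))

lemma measurableSet_active (a : ℕ × ℕ) :
    MeasurableSet {z : ℕ → ℕ × (ℕ → E) | Active z a} :=
  measurableSet_lt measurable_const (measurable_fst.comp (measurable_pi_apply a.1))

lemma measurableSet_isFirst_prod {𝒳 : Type*} [MeasurableSpace 𝒳] {score : 𝒳 → E → ℝ≥0∞}
    (hs : Measurable (Function.uncurry score)) (a : ℕ × ℕ) :
    MeasurableSet {p : 𝒳 × (ℕ → ℕ × (ℕ → E)) | IsFirst (score p.1) p.2 a} := by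
  have hpt : ∀ b, Measurable fun p : 𝒳 × (ℕ → ℕ × (ℕ → E)) => score p.1 (point p.2 b) := fun b =>
    hs.comp (measurable_fst.prodMk ((measurable_point b).comp measurable_snd))
  have hact : ∀ b, MeasurableSet {p : 𝒳 × (ℕ → ℕ × (ℕ → E)) | Active p.2 b} := fun b =>
    measurable_snd (measurableSet_active b)
  have : {p : 𝒳 × (ℕ → ℕ × (ℕ → E)) | IsFirst (score p.1) p.2 a} =
      {p | Active p.2 a} ∩ ⋂ b, {p | b ≠ a → Active p.2 b →
        score p.1 (point p.2 a) < score p.1 (point p.2 b)} := by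
    ext p; simp [IsFirst]
  rw [this]
  refine (hact a).inter (MeasurableSet.iInter fun b => ?_)
  refine MeasurableSet.imp (.const _) ?_
  exact MeasurableSet.imp (hact b) (measurableSet_lt (hpt a) (hpt b))

lemma measurableSet_isFirst {score : E → ℝ≥0∞} (hs : Measurable score) (a : ℕ × ℕ) :
    MeasurableSet {z | IsFirst score z a} :=
  measurable_prodMk_left (x := ()) (measurableSet_isFirst_prod (𝒳 := Unit)
    (score := fun _ => score) (hs.comp measurable_snd) a)

/-- Resampling one entry of one slab. -/
lemma lintegral_slabLaw_resample (ν : Measure E) [IsProbabilityMeasure ν] (i : ℕ)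
    {F : ℕ × (ℕ → E) → ℝ≥0∞} (hF : Measurable F) :
    ∫⁻ c, F c ∂(slabLaw ν) =
      ∫⁻ e, ∫⁻ c, F (c.1, Function.update c.2 i e) ∂(slabLaw ν) ∂ν := by
  have hup := measurePreserving_update_infinitePi (fun _ : ℕ => ν) i
  have hm : Measurable fun p : E × (ℕ × (ℕ → E)) => F (p.2.1, Function.update p.2.2 i p.1) :=
    hF.comp ((measurable_fst.comp measurable_snd).prodMk (hup.measurable.comp
      (measurable_fst.prodMk (measurable_snd.comp measurable_snd))))
  unfold slabLaw
  rw [lintegral_prod _ hF.aemeasurable]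
  have h1 : ∀ e : E, ∫⁻ c, F (c.1, Function.update c.2 i e)
      ∂((poissonMeasure 1).prod (Measure.infinitePi fun _ : ℕ => ν)) =
      ∫⁻ k, ∫⁻ y, F (k, Function.update y i e) ∂(Measure.infinitePi fun _ : ℕ => ν)
        ∂(poissonMeasure 1) := fun e =>
    lintegral_prod _ (hm.comp measurable_prodMk_left).aemeasurable
  simp_rw [h1]
  rw [lintegral_lintegral_swap (μ := ν)]
  · refine lintegral_congr fun k => ?_
    refine (hup.lintegral_comp (f := fun y => F (k, y))
      (hF.comp measurable_prodMk_left)).symm.trans ?_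
    exact lintegral_prod _ ((hF.comp measurable_prodMk_left).comp hup.measurable).aemeasurable
  · refine Measurable.aemeasurable ?_
    refine Measurable.lintegral_prod_right' (f := fun q : (E × ℕ) × (ℕ → E) =>
      F (q.1.2, Function.update q.2 i q.1.1)) ?_
    exact hF.comp ((measurable_snd.comp measurable_fst).prodMk (hup.measurable.comp
      ((measurable_fst.comp measurable_fst).prodMk measurable_snd)))

/-- Resampling one entry of the process. -/
lemma lintegral_poissonLaw_resample (ν : ℕ → Measure E) [∀ n, IsProbabilityMeasure (ν n)]
    (a : ℕ × ℕ) {F : (ℕ → ℕ × (ℕ → E)) → ℝ≥0∞} (hF : Measurable F) :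
    ∫⁻ z, F z ∂(poissonLaw ν) = ∫⁻ e, ∫⁻ c, ∫⁻ z,
      F (Function.update z a.1 (c.1, Function.update c.2 a.2 e)) ∂(poissonLaw ν)
        ∂(slabLaw (ν a.1)) ∂(ν a.1) := by
  have hup := measurePreserving_update_infinitePi (fun n => slabLaw (ν n)) a.1
  have hm : Measurable fun p : (ℕ × (ℕ → E)) × (ℕ → ℕ × (ℕ → E)) =>
      F (Function.update p.2 a.1 p.1) := hF.comp hup.measurable
  unfold poissonLaw
  rw [← hup.lintegral_comp hF, lintegral_prod _ hm.aemeasurable,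
    lintegral_slabLaw_resample (ν a.1) a.2 hm.lintegral_prod_right']

end

/-! ### The first point of a Poisson process -/

section

variable {E : Type*} [MeasurableSpace E]

lemma measurableSet_forall_lt_mem {V : Set E} (hV : MeasurableSet V) :
    MeasurableSet {c : ℕ × (ℕ → E) | ∀ j < c.1, c.2 j ∈ V} := by
  simp only [Set.ofPred_forall]
  refine MeasurableSet.iInter fun j => MeasurableSet.imp ?_ ?_
  · exact measurableSet_lt measurable_const measurable_fst
  · exact ((measurable_pi_apply j).comp measurable_snd) hV

/-- The probability that no point of a slab lies in `V`. -/
lemma slabLaw_void (ν : Measure E) [IsProbabilityMeasure ν] {V : Set E} (hV : MeasurableSet V) :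
    slabLaw ν {c | ∀ j < c.1, c.2 j ∈ Vᶜ} = ENNReal.ofReal (Real.exp (-ν.real V)) := by
  have hp : ν Vᶜ = ENNReal.ofReal (1 - ν.real V) := by
    rw [← probReal_compl_eq_one_sub hV, ofReal_measureReal]
  rw [← lintegral_pow_poissonMeasure measureReal_le_one, ← hp]
  unfold slabLaw
  rw [Measure.prod_apply (measurableSet_forall_lt_mem hV.compl)]
  refine lintegral_congr fun k => ?_
  have : Prod.mk k ⁻¹' {c : ℕ × (ℕ → E) | ∀ j < c.1, c.2 j ∈ Vᶜ} =
      ((Finset.range k : Finset ℕ) : Set ℕ).pi fun _ => Vᶜ := by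
    ext y; simp [Set.mem_pi]
  rw [this, Measure.infinitePi_pi _ fun _ _ => hV.compl]
  simp

/-- A lower bound for the probability that a Poisson process has no point in `V`. The factor for
slab `n` stands apart: it is where a resampled point is put. -/
lemma exp_neg_le_void (ν : ℕ → Measure E) [∀ n, IsProbabilityMeasure (ν n)] {V : Set E}
    (hV : MeasurableSet V) {s : ℝ} (hs : 0 ≤ s) (hVs : ∑' n, ν n V ≤ ENNReal.ofReal s) (n : ℕ) :
    ENNReal.ofReal (Real.exp (-s)) ≤ (∫⁻ k, (ν n Vᶜ) ^ k ∂(poissonMeasure 1)) *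
      poissonLaw ν (({n}ᶜ : Set ℕ).pi fun _ => {c | ∀ j < c.1, c.2 j ∈ Vᶜ}) := by
  have hp : ν n Vᶜ = ENNReal.ofReal (1 - (ν n).real V) := by
    rw [← probReal_compl_eq_one_sub hV, ofReal_measureReal]
  unfold poissonLaw
  rw [hp, lintegral_pow_poissonMeasure measureReal_le_one,
    Measure.infinitePi_pi_of_countable _ (Set.to_countable _)
      (fun _ _ => measurableSet_forall_lt_mem hV.compl),
    ENNReal.tprod_eq_iInf_prod (by simp [prob_le_one])]
  have hle : ENNReal.ofReal (Real.exp (-(s - (ν n).real V))) ≤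
      ⨅ t : Finset ({n}ᶜ : Set ℕ), ∏ i ∈ t, slabLaw (ν i) {c | ∀ j < c.1, c.2 j ∈ Vᶜ} := by
    refine le_iInf fun t => ?_
    simp_rw [slabLaw_void _ hV]
    rw [← ENNReal.ofReal_prod_of_nonneg fun _ _ => (Real.exp_pos _).le, ← Real.exp_sum]
    refine ENNReal.ofReal_le_ofReal (Real.exp_le_exp.2 ?_)
    rw [Finset.sum_neg_distrib, neg_le_neg_iff]
    have hn : n ∉ t.map (Function.Embedding.subtype _) := by simp
    have h1 : ∑ i ∈ insert n (t.map (Function.Embedding.subtype _)), ν i V ≤ ENNReal.ofReal s :=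
      (ENNReal.sum_le_tsum _).trans hVs
    have h2 := ENNReal.toReal_mono ENNReal.ofReal_ne_top h1
    rw [ENNReal.toReal_ofReal hs, ENNReal.toReal_sum (by simp), Finset.sum_insert hn,
      Finset.sum_map] at h2
    simp only [Measure.real]
    simp only [Function.Embedding.subtype_apply] at h2
    linarith
  refine le_trans (le_of_eq ?_) (mul_le_mul_right hle _)
  rw [← ENNReal.ofReal_mul (Real.exp_pos _).le, ← Real.exp_add]
  congr 2; ring

/-- The measure of the event that the point with label `a` is the first, and lies in a given place,
in terms of the reduced process, in which that point is absent. -/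
lemma setLIntegral_isFirst (ν : ℕ → Measure E) [∀ n, IsProbabilityMeasure (ν n)]
    (a : ℕ × ℕ) {score : E → ℝ≥0∞} (hs : Measurable score) {h : E → ℝ≥0∞} (hh : Measurable h) :
    ∫⁻ z in {z | IsFirst score z a}, h (point z a) ∂(poissonLaw ν) =
      ∫⁻ e, h e * ((∫⁻ k, (if a.2 < k then (ν a.1 {e' | score e < score e'}) ^ (k - 1) else 0)
          ∂(poissonMeasure 1)) *
        poissonLaw ν (({a.1}ᶜ : Set ℕ).pi fun _ => {c | ∀ j < c.1, score e < score (c.2 j)}))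
          ∂(ν a.1) := by
  rw [← lintegral_indicator (measurableSet_isFirst hs a),
    lintegral_poissonLaw_resample ν a (F := {z | IsFirst score z a}.indicator
      fun z => h (point z a)) ((hh.comp (measurable_point a)).indicator
      (measurableSet_isFirst hs a))]
  refine lintegral_congr fun e => ?_
  set A : Set (ℕ × (ℕ → E)) := {c | a.2 < c.1 ∧ ∀ j < c.1, j ≠ a.2 → score e < score (c.2 j)}
  set B : Set (ℕ → ℕ × (ℕ → E)) :=
    ({a.1}ᶜ : Set ℕ).pi fun _ => {c | ∀ j < c.1, score e < score (c.2 j)}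
  have hV : MeasurableSet {e' | score e < score e'} := measurableSet_lt measurable_const hs
  have hA : MeasurableSet A := by
    refine MeasurableSet.inter (measurableSet_lt measurable_const measurable_fst) ?_
    change MeasurableSet {c : ℕ × (ℕ → E) | ∀ j < c.1, j ≠ a.2 → score e < score (c.2 j)}
    simp only [Set.ofPred_forall]
    refine MeasurableSet.iInter fun j => MeasurableSet.imp ?_ (MeasurableSet.imp (.const _) ?_)
    · exact measurableSet_lt measurable_const measurable_fst
    · exact measurableSet_lt measurable_const (hs.comp (by fun_prop))
  have hB : MeasurableSet B :=
    MeasurableSet.pi (Set.to_countable _) fun _ _ => measurableSet_forall_lt_mem hV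
  have hfirst : ∀ c z, IsFirst score (Function.update z a.1 (c.1, Function.update c.2 a.2 e)) a ↔
      c ∈ A ∧ z ∈ B := by
    intro c z
    constructor
    · rintro ⟨h1, h2⟩
      refine ⟨⟨by simpa [Active] using h1, fun j hj hja => ?_⟩, fun m hm j hj => ?_⟩
      · simpa [point, hja] using h2 (a.1, j) (fun h => hja (congrArg Prod.snd h))
          (by simpa [Active] using hj)
      · have hm' : m ≠ a.1 := hm
        simpa [point, hm'] using h2 (m, j) (fun h => hm' (congrArg Prod.fst h))
          (by simpa [Active, hm'] using hj)
    · rintro ⟨⟨h1, h2⟩, h3⟩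
      refine ⟨by simpa [Active] using h1, fun b hb hact => ?_⟩
      by_cases hba : b.1 = a.1
      · have hb2 : b.2 ≠ a.2 := fun h => hb (Prod.ext hba h)
        simp only [Active, hba, Function.update_self] at hact
        simpa [point, hba, hb2] using h2 b.2 hact hb2
      · simp only [Active, Function.update_of_ne hba] at hact
        simpa [point, hba] using h3 b.1 hba b.2 hact
  have hpt : ∀ (c : ℕ × (ℕ → E)) z,
      point (Function.update z a.1 (c.1, Function.update c.2 a.2 e)) a = e := by
    intro c z; simp [point]
  have hint : ∀ c z, {z | IsFirst score z a}.indicator (fun z => h (point z a))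
      (Function.update z a.1 (c.1, Function.update c.2 a.2 e)) =
      h e * (A.indicator 1 c * B.indicator 1 z) := by
    intro c z
    by_cases h1 : c ∈ A <;> by_cases h2 : z ∈ B <;>
      simp [Set.indicator, hfirst, h1, h2, hpt]
  simp_rw [hint]
  have h1 : ∀ c, ∫⁻ z, h e * (A.indicator 1 c * B.indicator 1 z) ∂(poissonLaw ν) =
      h e * (A.indicator 1 c * poissonLaw ν B) := by
    intro c
    rw [lintegral_const_mul _ ((measurable_one.indicator hB).const_mul _),
      lintegral_const_mul _ (measurable_one.indicator hB), lintegral_indicator_one hB]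
  simp_rw [h1]
  rw [lintegral_const_mul _ ((measurable_one.indicator hA).mul_const _),
    lintegral_mul_const _ (measurable_one.indicator hA), lintegral_indicator_one hA]
  congr 2
  unfold slabLaw
  rw [Measure.prod_apply hA]
  refine lintegral_congr fun k => ?_
  have hsec : Prod.mk k ⁻¹' A = if a.2 < k then
      (((Finset.range k).erase a.2 : Finset ℕ) : Set ℕ).pi fun _ => {e' | score e < score e'}
      else ∅ := by
    ext y
    split_ifs with hk
    · simp [A, hk, Set.mem_pi]
    · simp [A, hk]
  rw [hsec]
  split_ifs with hk
  · rw [Measure.infinitePi_pi _ fun _ _ => measurableSet_lt measurable_const hs]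
    simp [Finset.card_erase_of_mem, hk]
  · simp

/-- The density of the first point of a Poisson process: if the points of score at most `s` have
intensity at most `s`, then the point of smallest score is at `e` with density at least
`exp (- score e)`. -/
lemma lintegral_exp_neg_score_le (ν : ℕ → Measure E) [∀ n, IsProbabilityMeasure (ν n)]
    {score : E → ℝ≥0∞} (hs : Measurable score)
    (hν : ∀ s : ℝ≥0∞, s ≠ ∞ → ∑' n, ν n {e | score e ≤ s} ≤ s)
    {h : E → ℝ≥0∞} (hh : Measurable h) :
    ∑' n, ∫⁻ e in {e | score e ≠ ∞}, h e * ENNReal.ofReal (Real.exp (-(score e).toReal)) ∂(ν n) ≤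
      ∑' a, ∫⁻ z in {z | IsFirst score z a}, h (point z a) ∂(poissonLaw ν) := by
  rw [ENNReal.tsum_prod']
  refine ENNReal.tsum_le_tsum fun n => ?_
  simp_rw [setLIntegral_isFirst ν _ hs hh]
  have hlt : MeasurableSet {p : E × E | score p.1 < score p.2} :=
    measurableSet_lt (hs.comp measurable_fst) (hs.comp measurable_snd)
  have hM : ∀ i : ℕ, Measurable fun e => ∫⁻ k, (if i < k then
      (ν n {e' | score e < score e'}) ^ (k - 1) else 0) ∂(poissonMeasure 1) := by
    intro i
    simp_rw [lintegral_countable']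
    refine Measurable.tsum fun k => Measurable.mul_const ?_ _
    split_ifs
    · exact (measurable_measure_prodMk_left hlt).pow_const _
    · exact measurable_const
  have hW : Measurable fun e => poissonLaw ν (({n}ᶜ : Set ℕ).pi fun _ =>
      {c | ∀ j < c.1, score e < score (c.2 j)}) := by
    have : MeasurableSet {p : E × (ℕ → ℕ × (ℕ → E)) | ∀ m ∈ ({n}ᶜ : Set ℕ), ∀ j < (p.2 m).1,
        score p.1 < score ((p.2 m).2 j)} := by
      simp only [Set.ofPred_forall]
      refine MeasurableSet.iInter fun m => MeasurableSet.iInter fun _ =>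
        MeasurableSet.iInter fun j => MeasurableSet.imp ?_ ?_
      · exact measurableSet_lt measurable_const (by fun_prop)
      · exact measurableSet_lt (hs.comp measurable_fst) (hs.comp (by fun_prop))
    exact measurable_measure_prodMk_left this
  refine le_of_le_of_eq ?_ (lintegral_tsum fun i => (hh.mul ((hM i).mul hW)).aemeasurable)
  have htop : MeasurableSet {e | score e ≠ ∞} :=
    (measurableSet_eq_fun hs measurable_const).compl
  rw [← lintegral_indicator htop]
  refine lintegral_mono fun e => ?_
  by_cases he : score e = ∞
  · simp [he]
  simp only [Set.indicator, Set.mem_ofPred_eq, ne_eq, he, not_false_eq_true, if_true]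
  rw [ENNReal.tsum_mul_left, ENNReal.tsum_mul_right]
  refine mul_le_mul_right ?_ _
  -- summing over the entries of slab `n` restores the void probability of a full Poisson slab
  rw [tsum_lintegral_poissonMeasure_pred fun k => (ν n {e' | score e < score e'}) ^ k]
  have hc : {e' | score e' ≤ score e}ᶜ = {e' | score e < score e'} := by ext; simp
  have := exp_neg_le_void ν (measurableSet_le hs measurable_const : MeasurableSet
    {e' | score e' ≤ score e}) (ENNReal.toReal_nonneg (a := score e))
    (by rw [ENNReal.ofReal_toReal he]; exact hν _ he) n
  rw [hc] at this
  exact this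

lemma tsum_measure_isFirst_le_one (ν : ℕ → Measure E) [∀ n, IsProbabilityMeasure (ν n)]
    {score : E → ℝ≥0∞} (hs : Measurable score) :
    ∑' a, poissonLaw ν {z | IsFirst score z a} ≤ 1 := by
  rw [← measure_iUnion _ (measurableSet_isFirst hs)]
  · exact prob_le_one
  · exact fun a b hab => Set.disjoint_left.2 fun z ha hb => hab (ha.unique hb)

/-- The lower bound `lintegral_exp_neg_score_le` is an equality as soon as the density in it has
total mass one. -/
lemma tsum_setLIntegral_isFirst (ν : ℕ → Measure E) [∀ n, IsProbabilityMeasure (ν n)]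
    {score : E → ℝ≥0∞} (hs : Measurable score)
    (hν : ∀ s : ℝ≥0∞, s ≠ ∞ → ∑' n, ν n {e | score e ≤ s} ≤ s)
    (hmass : ∑' n, ∫⁻ e in {e | score e ≠ ∞},
      ENNReal.ofReal (Real.exp (-(score e).toReal)) ∂(ν n) = 1)
    {h : E → ℝ≥0∞} (hh : Measurable h) :
    ∑' a, ∫⁻ z in {z | IsFirst score z a}, h (point z a) ∂(poissonLaw ν) =
      ∑' n, ∫⁻ e in {e | score e ≠ ∞},
        h e * ENNReal.ofReal (Real.exp (-(score e).toReal)) ∂(ν n) := by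
  set d : E → ℝ≥0∞ := fun e => ENNReal.ofReal (Real.exp (-(score e).toReal)) with hd
  have hdm : Measurable d := (Real.measurable_exp.comp hs.ennreal_toReal.neg).ennreal_ofReal
  set D : Measure E := Measure.sum fun n => ((ν n).restrict {e | score e ≠ ∞}).withDensity d
  set L : Measure E := Measure.sum fun a =>
    ((poissonLaw ν).restrict {z | IsFirst score z a}).map fun z => point z a
  have hD : ∀ {h : E → ℝ≥0∞}, Measurable h → ∫⁻ e, h e ∂D =
      ∑' n, ∫⁻ e in {e | score e ≠ ∞}, h e * d e ∂(ν n) := by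
    intro h hh
    rw [lintegral_sum_measure]
    refine tsum_congr fun n => ?_
    rw [lintegral_withDensity_eq_lintegral_mul _ hdm hh]
    exact lintegral_congr fun e => mul_comm _ _
  have hL : ∀ {h : E → ℝ≥0∞}, Measurable h → ∫⁻ e, h e ∂L =
      ∑' a, ∫⁻ z in {z | IsFirst score z a}, h (point z a) ∂(poissonLaw ν) := by
    intro h hh
    rw [lintegral_sum_measure]
    exact tsum_congr fun a => lintegral_map hh (measurable_point a)
  have hle : D ≤ L := by
    refine Measure.le_iff.2 fun s hs' => ?_
    rw [← lintegral_indicator_one hs', ← lintegral_indicator_one hs',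
      hD (measurable_one.indicator hs'), hL (measurable_one.indicator hs')]
    exact lintegral_exp_neg_score_le ν hs hν (measurable_one.indicator hs')
  have hD1 : D Set.univ = 1 := by
    rw [← lintegral_one, hD measurable_const]
    simpa only [one_mul] using hmass
  have hL1 : L Set.univ ≤ 1 := by
    rw [← lintegral_one, hL measurable_const]
    simpa using tsum_measure_isFirst_le_one ν hs
  have : IsFiniteMeasure L := ⟨hL1.trans_lt ENNReal.one_lt_top⟩
  have hDL : D = L := by
    have : IsFiniteMeasure D := ⟨by rw [hD1]; exact ENNReal.one_lt_top⟩
    exact Measure.eq_of_le_of_measure_univ_eq hle (le_antisymm (hle _) (by rw [hD1]; exact hL1))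
  rw [← hL hh, ← hD hh, hDL]

/-- Campbell's formula. -/
lemma tsum_setLIntegral_active (ν : ℕ → Measure E) [∀ n, IsProbabilityMeasure (ν n)]
    {r : E → ℝ≥0∞} (hr : Measurable r) :
    ∑' a, ∫⁻ z in {z | Active z a}, r (point z a) ∂(poissonLaw ν) = ∑' n, ∫⁻ e, r e ∂(ν n) := by
  rw [ENNReal.tsum_prod']
  refine tsum_congr fun n => ?_
  have h1 : ∀ i, ∫⁻ z in {z | Active z (n, i)}, r (point z (n, i)) ∂(poissonLaw ν) =
      (∫⁻ e, r e ∂(ν n)) * ∫⁻ k, (if i < k then 1 else 0) ∂(poissonMeasure 1) := by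
    intro i
    rw [← lintegral_indicator (measurableSet_active _),
      lintegral_poissonLaw_resample ν (n, i) (F := {z | Active z (n, i)}.indicator
        fun z => r (point z (n, i))) ((hr.comp (measurable_point _)).indicator
        (measurableSet_active _)), ← lintegral_mul_const _ hr]
    refine lintegral_congr fun e => ?_
    have : ∀ (c : ℕ × (ℕ → E)) z, {z | Active z (n, i)}.indicator (fun z => r (point z (n, i)))
        (Function.update z n (c.1, Function.update c.2 i e)) =
        r e * (if i < c.1 then 1 else 0) := by
      intro c z
      by_cases h : i < c.1 <;> simp [Set.indicator, Active, point, h]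
    simp_rw [this]
    simp only [lintegral_const, measure_univ, mul_one]
    rw [lintegral_const_mul _ (Measurable.ite (measurableSet_lt measurable_const measurable_fst)
      measurable_const measurable_const)]
    congr 1
    unfold slabLaw
    rw [lintegral_prod _ (Measurable.ite (measurableSet_lt measurable_const measurable_fst)
      measurable_const measurable_const).aemeasurable]
    refine lintegral_congr fun k => ?_
    exact (lintegral_const (μ := Measure.infinitePi fun _ : ℕ => ν n)
      (if i < k then 1 else 0)).trans (by rw [measure_univ, mul_one])
  simp_rw [h1]
  rw [ENNReal.tsum_mul_left]
  have := tsum_lintegral_poissonMeasure_pred fun _ => 1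
  simp only [lintegral_one, measure_univ] at this
  rw [this, mul_one]

end

/-! ### The process with intensity `dt × q` -/

section

lemma lintegral_exp_neg_div {f : ℝ} (hf : 0 < f) :
    ∫⁻ t in Set.Ioi (0 : ℝ), ENNReal.ofReal (Real.exp (-(t / f))) = ENNReal.ofReal f := by
  have h := Real.integral_rpow_mul_exp_neg_mul_Ioi (a := 1) (r := 1 / f) one_pos (by positivity)
  simp at h
  have h' : ∫ t in Set.Ioi (0 : ℝ), Real.exp (-(t / f)) = f := by
    refine (integral_congr_ae (ae_of_all _ fun t => ?_)).trans h
    simp [div_eq_inv_mul]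
  rw [← ofReal_integral_eq_lintegral_ofReal (.of_integral_ne_zero (by rw [h']; exact hf.ne'))
    (ae_of_all _ fun t => (Real.exp_pos _).le), h']

lemma lintegral_mul_exp_neg_div {f : ℝ} (hf : 0 < f) :
    ∫⁻ t in Set.Ioi (0 : ℝ), ENNReal.ofReal (t * Real.exp (-(t / f))) = ENNReal.ofReal (f * f) := by
  have h := Real.integral_rpow_mul_exp_neg_mul_Ioi (a := 2) (r := 1 / f) two_pos (by positivity)
  norm_num at h
  have h' : ∫ t in Set.Ioi (0 : ℝ), t * Real.exp (-(t / f)) = f * f := by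
    rw [← sq, ← h]; simp [div_eq_inv_mul]
  rw [← ofReal_integral_eq_lintegral_ofReal (.of_integral_ne_zero (by rw [h']; positivity)) _, h']
  filter_upwards [ae_restrict_mem measurableSet_Ioi] with t ht
  have : 0 < t := ht
  positivity

variable {𝒴 : Type v}

/-- The score `t / f u` of the point `(t, u)` for the density `f`. With `t > 0` it is `∞` where the
density vanishes. -/
noncomputable def score (f : 𝒴 → ℝ≥0) (e : ℝ × 𝒴) : ℝ≥0∞ := ENNReal.ofReal e.1 / f e.2

lemma score_eq_top_iff (f : 𝒴 → ℝ≥0) {t : ℝ} (ht : 0 < t) (u : 𝒴) :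
    score f (t, u) = ∞ ↔ f u = 0 := by
  simp [score, ENNReal.div_eq_top, ht]

variable [MeasurableSpace 𝒴]

/-- Lebesgue measure on `(n, n + 1]` times `q`: the intensity of slab `n`. -/
noncomputable def slabIntensity (q : Measure 𝒴) (n : ℕ) : Measure (ℝ × 𝒴) :=
  (volume.restrict (Set.Ioc (n : ℝ) (n + 1))).prod q

instance (q : Measure 𝒴) [IsProbabilityMeasure q] (n : ℕ) :
    IsProbabilityMeasure (slabIntensity q n) := by
  have : IsProbabilityMeasure (volume.restrict (Set.Ioc (n : ℝ) (n + 1))) := ⟨by simp⟩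
  unfold slabIntensity; infer_instance

/-- The slab intensities add up to Lebesgue measure on `(0, ∞)` times `q`. -/
lemma tsum_lintegral_slabIntensity (q : Measure 𝒴) [IsProbabilityMeasure q]
    {F : ℝ × 𝒴 → ℝ≥0∞} (hF : Measurable F) :
    ∑' n, ∫⁻ e, F e ∂(slabIntensity q n) = ∫⁻ u, (∫⁻ t in Set.Ioi (0 : ℝ), F (t, u)) ∂q := by
  unfold slabIntensity
  simp_rw [fun n : ℕ => lintegral_prod_symm' (μ := volume.restrict (Set.Ioc (n : ℝ) (n + 1)))
    (ν := q) F hF]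
  rw [← lintegral_tsum fun n => hF.lintegral_prod_left'.aemeasurable]
  refine lintegral_congr fun u => ?_
  have hU : Set.Ioi (0 : ℝ) = ⋃ n : ℕ, Set.Ioc (n : ℝ) (n + 1) := by
    ext t
    simp only [Set.mem_Ioi, Set.mem_iUnion, Set.mem_Ioc]
    constructor
    · intro ht
      obtain ⟨m, hm⟩ : ∃ m, ⌈t⌉₊ = m + 1 := Nat.exists_eq_succ_of_ne_zero (Nat.ceil_pos.2 ht).ne'
      have h1 := Nat.le_ceil t
      have h2 := Nat.ceil_lt_add_one ht.le
      rw [hm] at h1 h2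
      push_cast at h1 h2
      exact ⟨m, by linarith, h1⟩
    · rintro ⟨n, h, -⟩
      exact (Nat.cast_nonneg n).trans_lt h
  rw [hU, lintegral_iUnion (fun _ => measurableSet_Ioc)]
  intro i j hij
  refine Set.disjoint_left.2 fun t h1 h2 => hij ?_
  have h3 : (i : ℝ) < j + 1 := h1.1.trans_le h2.2
  have h4 : (j : ℝ) < i + 1 := h2.1.trans_le h1.2
  norm_cast at h3 h4
  omega

lemma measurable_score {f : 𝒴 → ℝ≥0} (hf : Measurable f) : Measurable (score f) := by
  unfold score; fun_prop

/-- The points of score at most `s` have intensity at most `s`. -/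
lemma tsum_slabIntensity_score_le (q : Measure 𝒴) [IsProbabilityMeasure q] {f : 𝒴 → ℝ≥0}
    (hf : Measurable f) (hf1 : ∫⁻ u, f u ∂q = 1) (s : ℝ≥0∞) (hs : s ≠ ∞) :
    ∑' n, slabIntensity q n {e | score f e ≤ s} ≤ s := by
  have hm : MeasurableSet {e | score f e ≤ s} :=
    measurableSet_le (measurable_score hf) measurable_const
  simp_rw [← lintegral_indicator_one hm]
  rw [tsum_lintegral_slabIntensity q (measurable_one.indicator hm)]
  calc _ ≤ ∫⁻ u, s * f u ∂q := by
        refine lintegral_mono fun u => ?_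
        have : ∀ t : ℝ, {e | score f e ≤ s}.indicator 1 (t, u) =
            {t | score f (t, u) ≤ s}.indicator (1 : ℝ → ℝ≥0∞) t := fun t => rfl
        simp_rw [this]
        have hm' : MeasurableSet {t | score f (t, u) ≤ s} := measurable_prodMk_right hm
        rw [lintegral_indicator_one hm', Measure.restrict_apply hm']
        calc _ ≤ volume (Set.Ioc 0 (s.toReal * f u)) := by
              refine measure_mono fun t ht => ⟨ht.2, ?_⟩
              have h1 : ENNReal.ofReal t ≤ s * f u := by
                rw [← ENNReal.div_le_iff_le_mul (.inr hs) (.inl ENNReal.coe_ne_top)]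
                · exact ht.1
              have := ENNReal.toReal_mono (ENNReal.mul_ne_top hs ENNReal.coe_ne_top) h1
              have h0 : (0 : ℝ) ≤ t := le_of_lt ht.2
              simpa [ENNReal.toReal_ofReal h0] using this
          _ = _ := by
              rw [Real.volume_Ioc, sub_zero, ENNReal.ofReal_mul ENNReal.toReal_nonneg,
                ENNReal.ofReal_toReal hs, ENNReal.ofReal_coe_nnreal]
    _ = s := by rw [lintegral_const_mul _ (by fun_prop), hf1, mul_one]

/-- Integration against the density `exp (- score)`. -/
lemma tsum_setLIntegral_exp_neg_score (q : Measure 𝒴) [IsProbabilityMeasure q] {f : 𝒴 → ℝ≥0}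
    (hf : Measurable f) {h : ℝ × 𝒴 → ℝ≥0∞} (hh : Measurable h) :
    ∑' n, ∫⁻ e in {e | score f e ≠ ∞},
        h e * ENNReal.ofReal (Real.exp (-(score f e).toReal)) ∂(slabIntensity q n) =
      ∫⁻ u, (if f u = 0 then 0 else
        ∫⁻ t in Set.Ioi (0 : ℝ), h (t, u) * ENNReal.ofReal (Real.exp (-(t / f u)))) ∂q := by
  have hm : MeasurableSet {e | score f e ≠ ∞} :=
    (measurableSet_eq_fun (measurable_score hf) measurable_const).compl
  have hdm : Measurable fun e => h e * ENNReal.ofReal (Real.exp (-(score f e).toReal)) :=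
    hh.mul (Real.measurable_exp.comp (measurable_score hf).ennreal_toReal.neg).ennreal_ofReal
  simp_rw [← lintegral_indicator hm]
  rw [tsum_lintegral_slabIntensity q (hdm.indicator hm)]
  refine lintegral_congr fun u => ?_
  split_ifs with hu
  · rw [← lintegral_zero]
    refine setLIntegral_congr_fun measurableSet_Ioi fun t ht => ?_
    simp [Set.indicator, (score_eq_top_iff f ht u).2 hu]
  · refine setLIntegral_congr_fun measurableSet_Ioi fun t ht => ?_
    have h0 : (0 : ℝ) ≤ t := le_of_lt ht
    simp only [Set.indicator, Set.mem_ofPred_eq, ne_eq, score_eq_top_iff f ht u, hu,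
      not_false_eq_true, if_true]
    simp [score, ENNReal.toReal_ofReal h0]

/-- The law of the first point of the Poisson process with intensity `dt × q`, for the scores
`t / f u`. -/
lemma tsum_setLIntegral_isFirst_score (q : Measure 𝒴) [IsProbabilityMeasure q] {f : 𝒴 → ℝ≥0}
    (hf : Measurable f) (hf1 : ∫⁻ u, f u ∂q = 1) {h : ℝ × 𝒴 → ℝ≥0∞} (hh : Measurable h) :
    ∑' a, ∫⁻ z in {z | IsFirst (score f) z a}, h (point z a) ∂(poissonLaw (slabIntensity q)) =
      ∫⁻ u, (if f u = 0 then 0 else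
        ∫⁻ t in Set.Ioi (0 : ℝ), h (t, u) * ENNReal.ofReal (Real.exp (-(t / f u)))) ∂q := by
  rw [tsum_setLIntegral_isFirst _ (measurable_score hf) (tsum_slabIntensity_score_le q hf hf1) _ hh,
    tsum_setLIntegral_exp_neg_score q hf hh]
  have := tsum_setLIntegral_exp_neg_score q hf (measurable_const (a := (1 : ℝ≥0∞)))
  simp only [one_mul] at this
  rw [this, ← hf1]
  refine lintegral_congr fun u => ?_
  split_ifs with hu
  · simp [hu]
  · rw [lintegral_exp_neg_div (by positivity), ENNReal.ofReal_coe_nnreal]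

/-- For functions of the second coordinate only, the first point is distributed as `f • q`. -/
lemma tsum_setLIntegral_isFirst_score_snd (q : Measure 𝒴) [IsProbabilityMeasure q] {f : 𝒴 → ℝ≥0}
    (hf : Measurable f) (hf1 : ∫⁻ u, f u ∂q = 1) {h : 𝒴 → ℝ≥0∞} (hh : Measurable h) :
    ∑' a, ∫⁻ z in {z | IsFirst (score f) z a}, h (point z a).2 ∂(poissonLaw (slabIntensity q)) =
      ∫⁻ u, h u * f u ∂q := by
  rw [tsum_setLIntegral_isFirst_score q hf hf1 (h := fun e => h e.2) (hh.comp measurable_snd)]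
  refine lintegral_congr fun u => ?_
  split_ifs with hu
  · simp [hu]
  · dsimp only
    rw [lintegral_const_mul _ (by fun_prop), lintegral_exp_neg_div (by positivity),
      ENNReal.ofReal_coe_nnreal]

/-- Jensen's inequality for the logarithm and an exponential variable of mean `f`. -/
lemma lintegral_log_one_add_div_mul_exp_le {f w : ℝ} (hf : 0 < f) (hw : 0 < w) :
    ∫⁻ t in Set.Ioi (0 : ℝ), ENNReal.ofReal (Real.log (1 + t / w)) *
      ENNReal.ofReal (Real.exp (-(t / f))) ≤
      ENNReal.ofReal (Real.log (1 + f / w)) * ENNReal.ofReal f := by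
  have hb : 0 < 1 + f / w := by positivity
  set X := ∫⁻ t in Set.Ioi (0 : ℝ), ENNReal.ofReal (Real.log (1 + t / w)) *
      ENNReal.ofReal (Real.exp (-(t / f)))
  have hL : 0 ≤ Real.log (1 + f / w) := Real.log_nonneg (by
    have : 0 < f / w := by positivity
    linarith)
  -- the tangent of the logarithm at `1 + f / w`
  have htan : ∀ t ∈ Set.Ioi (0 : ℝ), ENNReal.ofReal (Real.log (1 + t / w)) *
      ENNReal.ofReal (Real.exp (-(t / f))) + ENNReal.ofReal (Real.exp (-(t / f))) ≤
      ENNReal.ofReal (Real.log (1 + f / w)) * ENNReal.ofReal (Real.exp (-(t / f))) +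
      (ENNReal.ofReal (1 / (1 + f / w)) * ENNReal.ofReal (Real.exp (-(t / f))) +
        ENNReal.ofReal (1 / w / (1 + f / w)) * ENNReal.ofReal (t * Real.exp (-(t / f)))) := by
    intro t ht
    have ht0 : 0 < t := ht
    have ha : 0 < 1 + t / w := by positivity
    have ha1 : 0 ≤ Real.log (1 + t / w) := Real.log_nonneg (by
      have : 0 < t / w := by positivity
      linarith)
    have hlog := Real.log_le_sub_one_of_pos (div_pos ha hb)
    rw [Real.log_div ha.ne' hb.ne'] at hlog
    have he := Real.exp_pos (-(t / f))
    rw [← ENNReal.ofReal_mul ha1, ← ENNReal.ofReal_mul hL, ← ENNReal.ofReal_mul (by positivity),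
      ← ENNReal.ofReal_mul (by positivity), ← ENNReal.ofReal_add (by positivity) he.le,
      ← ENNReal.ofReal_add (by positivity) (by positivity),
      ← ENNReal.ofReal_add (by positivity) (by positivity)]
    refine ENNReal.ofReal_le_ofReal ?_
    have hsplit : (1 + t / w) / (1 + f / w) = 1 / (1 + f / w) + 1 / w / (1 + f / w) * t := by
      field_simp
    rw [hsplit] at hlog
    nlinarith [mul_le_mul_of_nonneg_right hlog he.le]
  have hint := lintegral_mono_ae (ae_restrict_of_forall_mem (μ := volume) measurableSet_Ioi htan)
  rw [lintegral_add_right _ (by fun_prop), lintegral_add_right _ (by fun_prop),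
    lintegral_add_right _ (by fun_prop), lintegral_const_mul _ (by fun_prop),
    lintegral_const_mul _ (by fun_prop), lintegral_const_mul _ (by fun_prop),
    lintegral_exp_neg_div hf, lintegral_mul_exp_neg_div hf,
    ← ENNReal.ofReal_mul (p := 1 / (1 + f / w)) (by positivity),
    ← ENNReal.ofReal_mul (p := 1 / w / (1 + f / w)) (by positivity),
    ← ENNReal.ofReal_add (by positivity) (by positivity)] at hint
  have hone : 1 / (1 + f / w) * f + 1 / w / (1 + f / w) * (f * f) = f := by
    field_simp
  rw [hone] at hint
  exact (ENNReal.add_le_add_iff_right ENNReal.ofReal_ne_top).1 hint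

end

/-! ### Entropy bounds -/

section

lemma toENNReal_neg_log {k : ℝ≥0∞} (h0 : k ≠ 0) (ht : k ≠ ∞) :
    (-(ENNReal.log k)).toENNReal = ENNReal.ofReal (-Real.log k.toReal) := by
  rw [ENNReal.log_pos_real h0 ht, ← EReal.coe_neg, EReal.toENNReal_of_ne_top (EReal.coe_ne_top _),
    EReal.toReal_coe]

/-- The inequality `log x ≤ x - 1` at `x = exp (-b) / k`. -/
lemma neg_log_add_one_le {k : ℝ≥0∞} (hk : k ≤ 1) (b : ℝ) :
    (-(ENNReal.log k)).toENNReal + 1 ≤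
      ENNReal.ofReal b + ENNReal.ofReal (Real.exp (-b)) / k := by
  rcases eq_or_ne k 0 with rfl | h0
  · rw [ENNReal.div_zero (by simp [Real.exp_pos])]; simp
  have ht : k ≠ ∞ := (hk.trans_lt ENNReal.one_lt_top).ne
  have hpos : 0 < k.toReal := ENNReal.toReal_pos h0 ht
  have hk1 : k.toReal ≤ 1 := by simpa using ENNReal.toReal_mono ENNReal.one_ne_top hk
  have hlog := Real.log_le_sub_one_of_pos (div_pos (Real.exp_pos (-b)) hpos)
  rw [Real.log_div (Real.exp_pos _).ne' hpos.ne', Real.log_exp] at hlog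
  have hnl : 0 ≤ -Real.log k.toReal := by
    have := Real.log_nonpos hpos.le hk1
    linarith
  rw [toENNReal_neg_log h0 ht, ← ENNReal.ofReal_toReal ht, ENNReal.toReal_ofReal hpos.le,
    ← ENNReal.ofReal_div_of_pos hpos, ← ENNReal.ofReal_one, ← ENNReal.ofReal_add hnl zero_le_one]
  refine le_trans (ENNReal.ofReal_le_ofReal ?_) ENNReal.ofReal_add_le
  linarith

lemma measurable_kernel_singleton {𝒵 : Type*} {𝒴 : Type*} [MeasurableSpace 𝒵] [MeasurableSpace 𝒴]
    [StandardBorelSpace 𝒴] (κ : Kernel 𝒵 𝒴) [IsSFiniteKernel κ] :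
    Measurable fun p : 𝒵 × 𝒴 => κ p.1 {p.2} := by
  have ht : MeasurableSet {q : (𝒵 × 𝒴) × 𝒴 | q.2 = q.1.2} :=
    measurableSet_eq_fun measurable_snd (measurable_snd.comp measurable_fst)
  exact Kernel.measurable_kernel_prodMk_left (κ := κ.prodMkRight 𝒴) ht

/-- A random list of candidates `y j Z` with weights `r j Z` of total expected mass at most one
bounds the conditional entropy: it is at most the expected cost of the candidate that equals `Y`,
where a cost `b` needs a weight `exp (-b)`. -/
lemma lintegral_neg_log_kernel_le {Ω 𝒵 𝒴 J : Type*} [MeasurableSpace Ω] [MeasurableSpace 𝒵]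
    [MeasurableSpace 𝒴] [StandardBorelSpace 𝒴] [Countable J]
    (P : Measure Ω) [IsProbabilityMeasure P] (m : Measure 𝒵) [IsProbabilityMeasure m]
    (κ : Kernel 𝒵 𝒴) [IsMarkovKernel κ]
    {Z : Ω → 𝒵} {Y : Ω → 𝒴} (hZ : Measurable Z) (hY : Measurable Y)
    (hlaw : P.map (fun ω => (Z ω, Y ω)) = m ⊗ₘ κ)
    {y : J → 𝒵 → 𝒴} (hy : ∀ j, Measurable (y j)) {r : J → 𝒵 → ℝ≥0∞} (hr : ∀ j, Measurable (r j))
    (hmass : ∑' j, ∫⁻ z, r j z ∂m ≤ 1) (K : Ω → J) (b : Ω → ℝ)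
    (hK : ∀ᵐ ω ∂P, Y ω = y (K ω) (Z ω) ∧ ENNReal.ofReal (Real.exp (-(b ω))) ≤ r (K ω) (Z ω)) :
    ∫⁻ z, ∫⁻ y', (-(ENNReal.log (κ z {y'}))).toENNReal ∂(κ z) ∂m ≤
      ∫⁻ ω, ENNReal.ofReal (b ω) ∂P := by
  have hκ := measurable_kernel_singleton κ
  have hA : Measurable fun p : 𝒵 × 𝒴 => (-(ENNReal.log (κ p.1 {p.2}))).toENNReal :=
    (ENNReal.measurable_log.comp hκ).neg.ereal_toENNReal
  -- the likelihood ratio of the list against the conditional law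
  set C : 𝒵 × 𝒴 → ℝ≥0∞ := fun p =>
    ∑' j, {p : 𝒵 × 𝒴 | p.2 = y j p.1}.indicator (fun p => r j p.1 / κ p.1 {p.2}) p
  have hCj : ∀ j, Measurable ({p : 𝒵 × 𝒴 | p.2 = y j p.1}.indicator
      (fun p => r j p.1 / κ p.1 {p.2})) := fun j =>
    (((hr j).comp measurable_fst).div hκ).indicator
      (measurableSet_eq_fun measurable_snd ((hy j).comp measurable_fst))
  have hC : Measurable C := Measurable.tsum hCj
  have hC1 : ∫⁻ p, C p ∂(m ⊗ₘ κ) ≤ 1 := by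
    rw [lintegral_tsum fun j => (hCj j).aemeasurable]
    refine le_trans (ENNReal.tsum_le_tsum fun j => ?_) hmass
    rw [Measure.lintegral_compProd (hCj j)]
    refine lintegral_mono fun z => ?_
    have : ∀ y', {p : 𝒵 × 𝒴 | p.2 = y j p.1}.indicator (fun p => r j p.1 / κ p.1 {p.2}) (z, y') =
        ({y j z} : Set 𝒴).indicator (fun y' => r j z / κ z {y'}) y' := fun y' => rfl
    simp_rw [this]
    rw [lintegral_indicator (measurableSet_singleton _), lintegral_singleton, mul_comm]
    exact ENNReal.mul_div_le
  rw [← Measure.lintegral_compProd hA, ← hlaw, lintegral_map hA (hZ.prodMk hY)]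
  refine (ENNReal.add_le_add_iff_right ENNReal.one_ne_top).1 ?_
  calc _ = ∫⁻ ω, ((-(ENNReal.log (κ (Z ω) {Y ω}))).toENNReal + 1) ∂P := by
        rw [lintegral_add_right _ measurable_const]; simp
    _ ≤ ∫⁻ ω, (ENNReal.ofReal (b ω) + C (Z ω, Y ω)) ∂P := by
        refine lintegral_mono_ae ?_
        filter_upwards [hK] with ω hω
        refine (neg_log_add_one_le prob_le_one (b ω)).trans (add_le_add_right ?_ _)
        refine le_trans ?_ (ENNReal.le_tsum (K ω))
        rw [Set.indicator_of_mem (by exact hω.1)]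
        exact ENNReal.div_le_div_right hω.2 _
    _ = ∫⁻ ω, ENNReal.ofReal (b ω) ∂P + ∫⁻ p, C p ∂(m ⊗ₘ κ) := by
        have hCZY : Measurable fun ω => C (Z ω, Y ω) := hC.comp (hZ.prodMk hY)
        rw [lintegral_add_right _ hCZY, ← hlaw, lintegral_map hC (hZ.prodMk hY)]
    _ ≤ _ := add_le_add_right hC1 _

/-- A case of the Donsker–Varadhan inequality. -/
lemma lintegral_log_one_add_le_klDiv {Ω : Type*} [MeasurableSpace Ω] (P ν : Measure Ω)
    [IsProbabilityMeasure P] [IsProbabilityMeasure ν]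
    (hkl : InformationTheory.klDiv P ν ≠ ∞) {F : Ω → ℝ≥0} (hF : Measurable F)
    (hF2 : ∫⁻ ω, F ω ∂ν ≤ 2) :
    ∫⁻ ω, ENNReal.ofReal (Real.log (1 + F ω)) ∂P ≤
      ENNReal.ofReal ((InformationTheory.klDiv P ν).toReal + Real.log 3) := by
  obtain ⟨hac, hint⟩ := InformationTheory.klDiv_ne_top_iff.1 hkl
  rw [InformationTheory.toReal_klDiv_of_measure_eq hac (by simp)]
  set G := P.rnDeriv ν
  set H : Ω → ℝ≥0∞ := fun ω => (1 + F ω) / (3 * G ω)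
  have hHm : Measurable H := by
    have : Measurable G := Measure.measurable_rnDeriv _ _
    fun_prop
  have hGpos : ∀ᵐ ω ∂P, 0 < G ω := Measure.rnDeriv_pos hac
  have hGtop : ∀ᵐ ω ∂P, G ω < ∞ := hac (Measure.rnDeriv_lt_top P ν)
  have hH1 : ∫⁻ ω, H ω ∂P ≤ 1 := by
    rw [← lintegral_rnDeriv_mul hac hHm.aemeasurable]
    calc _ ≤ ∫⁻ ω, (1 + F ω) / 3 ∂ν := by
          refine lintegral_mono fun ω => ?_
          have h3 : H ω = (1 + F ω) / 3 / G ω := by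
            simp only [H, div_eq_mul_inv]
            rw [ENNReal.mul_inv (.inl (by norm_num)) (.inl (by norm_num)), mul_assoc]
          change G ω * H ω ≤ _
          rw [h3]
          exact ENNReal.mul_div_le
      _ ≤ 1 := by
          simp_rw [div_eq_mul_inv]
          rw [lintegral_mul_const _ (by fun_prop), lintegral_add_left measurable_const]
          simp only [lintegral_const, measure_univ, mul_one]
          rw [← div_eq_mul_inv]
          refine ENNReal.div_le_of_le_mul ?_
          calc _ ≤ (1 : ℝ≥0∞) + 2 := by gcongr
            _ = 1 * 3 := by norm_num
  have hHint : Integrable (fun ω => (H ω).toReal) P :=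
    integrable_toReal_of_lintegral_ne_top hHm.aemeasurable (hH1.trans_lt ENNReal.one_lt_top).ne
  have hHle : ∫ ω, (H ω).toReal ∂P ≤ 1 := by
    rw [integral_toReal hHm.aemeasurable
      (ae_lt_top hHm (hH1.trans_lt ENNReal.one_lt_top).ne)]
    simpa using ENNReal.toReal_mono ENNReal.one_ne_top hH1
  set φ : Ω → ℝ := fun ω => llr P ν ω + (Real.log 3 + ((H ω).toReal - 1))
  have hi1 : Integrable (fun ω => (H ω).toReal - 1) P := hHint.sub (integrable_const _)
  have hi2 : Integrable (fun ω => Real.log 3 + ((H ω).toReal - 1)) P := (integrable_const _).add hi1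
  have hφint : Integrable φ P := hint.add hi2
  have hle : ∀ᵐ ω ∂P, Real.log (1 + F ω) ≤ φ ω := by
    filter_upwards [hGpos, hGtop] with ω h0 ht
    have hg : 0 < (G ω).toReal := ENNReal.toReal_pos h0.ne' ht.ne
    have h1F : (0 : ℝ) < 1 + F ω := by positivity
    have hH : (H ω).toReal = (1 + F ω) / (3 * (G ω).toReal) := by
      simp [H, ENNReal.toReal_div, ENNReal.toReal_add]
    have hlog := Real.log_le_sub_one_of_pos (x := (1 + F ω) / (3 * (G ω).toReal)) (by positivity)
    rw [Real.log_div h1F.ne' (by positivity), Real.log_mul (by norm_num) hg.ne'] at hlog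
    simp only [φ, hH, llr]
    linarith
  calc _ ≤ ∫⁻ ω, ENNReal.ofReal (φ ω) ∂P :=
        lintegral_mono_ae (hle.mono fun ω h => ENNReal.ofReal_le_ofReal h)
    _ = ENNReal.ofReal (∫ ω, φ ω ∂P) := by
        rw [ofReal_integral_eq_lintegral_ofReal hφint]
        filter_upwards [hle] with ω h
        exact le_trans (Real.log_nonneg (by simp)) h
    _ ≤ _ := by
        refine ENNReal.ofReal_le_ofReal ?_
        have e1 : ∫ ω, φ ω ∂P = ∫ ω, llr P ν ω ∂P + (Real.log 3 + (∫ ω, (H ω).toReal ∂P - 1)) := by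
          rw [integral_add hint hi2, integral_add (integrable_const _) hi1,
            integral_sub hHint (integrable_const _)]
          simp
        rw [e1]; linarith

/-- The description cost, in nats, of a point `(t, u)`: `exp (-cost)` is the Pareto density of
exponent `1 + ε` at time `t`, on the scale `w u`. -/
noncomputable def cost {𝒴 : Type*} (ε : ℝ) (w : 𝒴 → ℝ≥0) (e : ℝ × 𝒴) : ℝ :=
  -Real.log ε + (1 + ε) * Real.log (1 + e.1 / w e.2)

lemma lintegral_exp_neg_cost {𝒴 : Type*} {ε : ℝ} (hε : 0 < ε) {w : 𝒴 → ℝ≥0} {u : 𝒴}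
    (hw : 0 < w u) :
    ∫⁻ t in Set.Ioi (0 : ℝ), ENNReal.ofReal (Real.exp (-cost ε w (t, u))) = w u := by
  have hw' : (0 : ℝ) < w u := hw
  have hpos : ∀ t : ℝ, 0 ≤ t → 0 < 1 + t / w u := fun t ht => by positivity
  have hexp : ∀ t ∈ Set.Ici (0 : ℝ), Real.exp (-cost ε w (t, u)) =
      ε * (1 + t / w u) ^ (-ε - 1) := by
    intro t ht
    rw [Real.rpow_def_of_pos (hpos t ht)]
    nth_rewrite 2 [← Real.exp_log hε]
    rw [← Real.exp_add]
    congr 1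
    simp only [cost]; ring
  have hderiv : ∀ t ∈ Set.Ici (0 : ℝ), HasDerivAt (fun t : ℝ => -(w u : ℝ) * (1 + t / w u) ^ (-ε))
      (Real.exp (-cost ε w (t, u))) t := by
    intro t ht
    have h1 : HasDerivAt (fun t : ℝ => 1 + t / (w u : ℝ)) (1 / w u) t :=
      ((hasDerivAt_id t).div_const _).const_add _
    have h2 := (h1.rpow_const (p := -ε) (.inl (hpos t ht).ne')).const_mul (-(w u : ℝ))
    convert! h2 using 1
    rw [hexp t ht]
    field_simp
  have hlim : Filter.Tendsto (fun t : ℝ => -(w u : ℝ) * (1 + t / w u) ^ (-ε)) Filter.atTop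
      (nhds 0) := by
    have h1 : Filter.Tendsto (fun t : ℝ => 1 + t / (w u : ℝ)) Filter.atTop Filter.atTop :=
      Filter.tendsto_atTop_add_const_left _ _ (Filter.tendsto_id.atTop_div_const hw')
    simpa using ((tendsto_rpow_neg_atTop hε).comp h1).const_mul (-(w u : ℝ))
  have hnn : ∀ t ∈ Set.Ioi (0 : ℝ), 0 ≤ Real.exp (-cost ε w (t, u)) :=
    fun t _ => (Real.exp_pos _).le
  rw [← ofReal_integral_eq_lintegral_ofReal
      (integrableOn_Ioi_deriv_of_nonneg' hderiv hnn hlim)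
      (ae_of_all _ fun t => (Real.exp_pos _).le),
    integral_Ioi_of_hasDerivAt_of_nonneg' hderiv hnn hlim]
  simp

lemma measurable_cost {𝒴 : Type*} [MeasurableSpace 𝒴] (ε : ℝ) {w : 𝒴 → ℝ≥0} (hw : Measurable w) :
    Measurable (cost ε w) := by
  unfold cost; fun_prop

end

/-! ### The Poisson functional representation -/

section

section Select

variable {E : Type*}

open Classical in
/-- The label of the point of smallest score, and `(0, 0)` if there is none. -/
noncomputable def firstLabel (s : E → ℝ≥0∞) (z : ℕ → ℕ × (ℕ → E)) : ℕ × ℕ :=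
  if h : ∃ a, IsFirst s z a then h.choose else (0, 0)

lemma IsFirst.firstLabel_eq {s : E → ℝ≥0∞} {z : ℕ → ℕ × (ℕ → E)} {a : ℕ × ℕ}
    (ha : IsFirst s z a) : firstLabel s z = a := by
  have h : ∃ a, IsFirst s z a := ⟨a, ha⟩
  rw [firstLabel, dif_pos h]
  exact h.choose_spec.unique ha

lemma measurable_firstLabel {𝒳 : Type*} [MeasurableSpace 𝒳] [MeasurableSpace E]
    {s : 𝒳 → E → ℝ≥0∞} (hs : Measurable (Function.uncurry s)) :
    Measurable fun p : 𝒳 × (ℕ → ℕ × (ℕ → E)) => firstLabel (s p.1) p.2 := by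
  have hF := measurableSet_isFirst_prod hs
  refine measurable_to_countable' fun a => ?_
  have : (fun p : 𝒳 × (ℕ → ℕ × (ℕ → E)) => firstLabel (s p.1) p.2) ⁻¹' {a} =
      {p | IsFirst (s p.1) p.2 a} ∪ ({_p | a = (0, 0)} ∩ (⋃ b, {p | IsFirst (s p.1) p.2 b})ᶜ) := by
    ext p
    simp only [Set.mem_preimage, Set.mem_singleton_iff, Set.mem_union, Set.mem_inter_iff,
      Set.mem_ofPred_eq, Set.mem_compl_iff, Set.mem_iUnion]
    by_cases h : ∃ b, IsFirst (s p.1) p.2 b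
    · obtain ⟨b, hb⟩ := h
      rw [hb.firstLabel_eq]
      constructor
      · rintro rfl; exact .inl hb
      · rintro (ha | ⟨-, hn⟩)
        · exact hb.unique ha
        · exact absurd ⟨b, hb⟩ hn
    · rw [firstLabel, dif_neg h]
      constructor
      · intro ha; exact .inr ⟨ha.symm, h⟩
      · rintro (ha | ⟨ha, -⟩)
        · exact absurd ⟨a, ha⟩ h
        · exact ha.symm
  rw [this]
  exact (hF a).union ((MeasurableSet.const _).inter (MeasurableSet.iUnion hF).compl)

lemma measurable_point_firstLabel {𝒳 : Type*} [MeasurableSpace 𝒳] [MeasurableSpace E]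
    {s : 𝒳 → E → ℝ≥0∞} (hs : Measurable (Function.uncurry s)) :
    Measurable fun p : 𝒳 × (ℕ → ℕ × (ℕ → E)) => point p.2 (firstLabel (s p.1) p.2) := by
  have h : Measurable fun p : (ℕ → ℕ × (ℕ → E)) × (ℕ × ℕ) => point p.1 p.2 :=
    measurable_from_prod_countable_left fun a => measurable_point a
  exact h.comp (measurable_snd.prodMk (measurable_firstLabel hs))

end Select

variable {𝒳 : Type*} [MeasurableSpace 𝒳] {𝒴 : Type*} [MeasurableSpace 𝒴]

lemma ae_exists_isFirst (q : Measure 𝒴) [IsProbabilityMeasure q] {f : 𝒴 → ℝ≥0}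
    (hf : Measurable f) (hf1 : ∫⁻ u, f u ∂q = 1) :
    ∀ᵐ z ∂(poissonLaw (slabIntensity q)), ∃ a, IsFirst (score f) z a := by
  have hs := measurable_score hf
  have h := tsum_setLIntegral_isFirst_score_snd q hf hf1 (measurable_const (a := (1 : ℝ≥0∞)))
  simp only [one_mul, hf1, lintegral_const, Measure.restrict_apply_univ] at h
  rw [← measure_iUnion (fun a b hab => Set.disjoint_left.2 fun z ha hb => hab (ha.unique hb))
    (measurableSet_isFirst hs)] at h
  have := (prob_compl_eq_zero_iff (MeasurableSet.iUnion (measurableSet_isFirst hs))).2 h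
  rw [ae_iff]
  convert! this using 2
  ext z; simp

lemma lintegral_point_firstLabel (q : Measure 𝒴) [IsProbabilityMeasure q] {f : 𝒴 → ℝ≥0}
    (hf : Measurable f) (hf1 : ∫⁻ u, f u ∂q = 1) (h : ℝ × 𝒴 → ℝ≥0∞) :
    ∫⁻ z, h (point z (firstLabel (score f) z)) ∂(poissonLaw (slabIntensity q)) =
      ∑' a, ∫⁻ z in {z | IsFirst (score f) z a}, h (point z a) ∂(poissonLaw (slabIntensity q)) := by
  have hs := measurable_score hf
  rw [← setLIntegral_univ, setLIntegral_congr (t := ⋃ a, {z | IsFirst (score f) z a}),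
    lintegral_iUnion (measurableSet_isFirst hs)
      (fun a b hab => Set.disjoint_left.2 fun z ha hb => hab (ha.unique hb))]
  · refine tsum_congr fun a => setLIntegral_congr_fun (measurableSet_isFirst hs a) fun z hz => ?_
    simp only [IsFirst.firstLabel_eq hz]
  · refine Filter.EventuallyEq.symm (ae_eq_univ.2 ?_)
    have := ae_exists_isFirst q hf hf1
    rw [ae_iff] at this
    convert! this using 2
    ext z; simp

/-- The Poisson functional representation: among the points `(t, u)` of the process, take the
second coordinate of the one with the smallest `t / f x u`. -/
noncomputable def select (f : 𝒳 → 𝒴 → ℝ≥0) (p : 𝒳 × (ℕ → ℕ × (ℕ → ℝ × 𝒴))) : 𝒴 :=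
  (point p.2 (firstLabel (score (f p.1)) p.2)).2

lemma measurable_uncurry_score {f : 𝒳 → 𝒴 → ℝ≥0} (hf : Measurable (Function.uncurry f)) :
    Measurable (Function.uncurry fun x => score (f x)) := by
  have h : Measurable fun p : 𝒳 × (ℝ × 𝒴) => f p.1 p.2.2 :=
    hf.comp (measurable_fst.prodMk (measurable_snd.comp measurable_snd))
  unfold score Function.uncurry
  fun_prop

lemma measurable_select {f : 𝒳 → 𝒴 → ℝ≥0} (hf : Measurable (Function.uncurry f)) :
    Measurable (select f) :=
  measurable_snd.comp (measurable_point_firstLabel (measurable_uncurry_score hf))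

/-- The pair `(X, select f (X, Z))` has law `μ ⊗ Q` if `f x` is a density of `Q x`. -/
lemma map_select (q : Measure 𝒴) [IsProbabilityMeasure q] (Q : Kernel 𝒳 𝒴) [IsMarkovKernel Q]
    {f : 𝒳 → 𝒴 → ℝ≥0} (hf : Measurable (Function.uncurry f)) (μ : Measure 𝒳) [SFinite μ]
    (hQ : ∀ᵐ x ∂μ, Q x = q.withDensity fun u => f x u) :
    (μ.prod (poissonLaw (slabIntensity q))).map (fun p => (p.1, select f p)) = μ ⊗ₘ Q := by
  have hsel := measurable_select hf
  refine Measure.ext_of_lintegral _ fun h hh => ?_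
  have hm : Measurable fun p => h (p.1, select f p) := hh.comp (measurable_fst.prodMk hsel)
  rw [lintegral_map hh (measurable_fst.prodMk hsel), Measure.lintegral_compProd hh,
    lintegral_prod _ hm.aemeasurable]
  refine lintegral_congr_ae ?_
  filter_upwards [hQ] with x hx
  have hfx : Measurable (f x) := hf.comp measurable_prodMk_left
  have hhx : Measurable fun u => h (x, u) := hh.comp measurable_prodMk_left
  have hf1 : ∫⁻ u, f x u ∂q = 1 := by
    have : Q x Set.univ = 1 := measure_univ
    rwa [hx, withDensity_apply _ .univ, setLIntegral_univ] at this
  rw [hx, lintegral_withDensity_eq_lintegral_mul _ (by fun_prop) hhx]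
  simp only [select]
  rw [lintegral_point_firstLabel q hfx hf1 (fun e => h (x, e.2)),
    tsum_setLIntegral_isFirst_score_snd q hfx hf1 hhx]
  simp [mul_comm]

/-- The expected cost of the selected point, given `x`. -/
lemma lintegral_cost_firstLabel_le (q : Measure 𝒴) [IsProbabilityMeasure q] {f : 𝒴 → ℝ≥0}
    (hf : Measurable f) (hf1 : ∫⁻ u, f u ∂q = 1) {w : 𝒴 → ℝ≥0} (hw : Measurable w)
    (hw0 : ∀ u, 0 < w u) {ε : ℝ} (hε : 0 < ε) :
    ∫⁻ z, ENNReal.ofReal (cost ε w (point z (firstLabel (score f) z)))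
        ∂(poissonLaw (slabIntensity q)) ≤
      ENNReal.ofReal (-Real.log ε) + ENNReal.ofReal (1 + ε) *
        ∫⁻ u, ENNReal.ofReal (Real.log (1 + f u / w u)) * f u ∂q := by
  rw [lintegral_point_firstLabel q hf hf1 (fun e => ENNReal.ofReal (cost ε w e)),
    tsum_setLIntegral_isFirst_score q hf hf1 (measurable_cost ε hw).ennreal_ofReal]
  have hm : Measurable fun u => ENNReal.ofReal (Real.log (1 + f u / w u)) * f u := by fun_prop
  calc _ ≤ ∫⁻ u, (ENNReal.ofReal (-Real.log ε) * f u + ENNReal.ofReal (1 + ε) *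
          (ENNReal.ofReal (Real.log (1 + f u / w u)) * f u)) ∂q := by
        refine lintegral_mono fun u => ?_
        split_ifs with hu
        · exact zero_le
        have hfu : (0 : ℝ) < f u := by positivity
        calc _ ≤ ∫⁻ t in Set.Ioi (0 : ℝ), (ENNReal.ofReal (-Real.log ε) *
              ENNReal.ofReal (Real.exp (-(t / f u))) + ENNReal.ofReal (1 + ε) *
                (ENNReal.ofReal (Real.log (1 + t / w u)) *
                  ENNReal.ofReal (Real.exp (-(t / f u))))) := by
              refine lintegral_mono fun t => ?_
              rw [← mul_assoc, ← add_mul]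
              gcongr
              rw [← ENNReal.ofReal_mul (by positivity)]
              exact ENNReal.ofReal_add_le
          _ ≤ _ := by
              rw [lintegral_add_left (by fun_prop), lintegral_const_mul _ (by fun_prop),
                lintegral_const_mul _ (by fun_prop), lintegral_exp_neg_div hfu,
                ENNReal.ofReal_coe_nnreal]
              gcongr
              have := lintegral_log_one_add_div_mul_exp_le hfu (NNReal.coe_pos.2 (hw0 u))
              rwa [ENNReal.ofReal_coe_nnreal] at this
    _ = _ := by
        rw [lintegral_add_left (by fun_prop), lintegral_const_mul _ (by fun_prop),
          lintegral_const_mul _ hm, hf1, mul_one]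

/-- The conditional entropy of the selected point given the process, in nats, for a free choice of
the scale `w` of the costs. -/
lemma lintegral_neg_log_select_le [StandardBorelSpace 𝒴] [Nonempty 𝒴]
    (q : Measure 𝒴) [IsProbabilityMeasure q] (Q : Kernel 𝒳 𝒴)
    [IsMarkovKernel Q] {f : 𝒳 → 𝒴 → ℝ≥0} (hf : Measurable (Function.uncurry f)) (μ : Measure 𝒳)
    [IsProbabilityMeasure μ] (hQ : ∀ᵐ x ∂μ, Q x = q.withDensity fun u => f x u)
    {w : 𝒴 → ℝ≥0} (hw : Measurable w) (hw0 : ∀ u, 0 < w u) (hw1 : ∫⁻ u, w u ∂q ≤ 1)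
    {ε : ℝ} (hε : 0 < ε) :
    ∫⁻ z, ∫⁻ y, (-(ENNReal.log (condDistrib (select f) Prod.snd
        (μ.prod (poissonLaw (slabIntensity q))) z {y}))).toENNReal
        ∂(condDistrib (select f) Prod.snd (μ.prod (poissonLaw (slabIntensity q))) z)
        ∂(poissonLaw (slabIntensity q)) ≤
      ENNReal.ofReal (-Real.log ε) + ENNReal.ofReal (1 + ε) *
        ∫⁻ p, ENNReal.ofReal (Real.log (1 + f p.1 p.2 / w p.2)) ∂(μ ⊗ₘ Q) := by
  have hsel := measurable_select hf
  have hcost := (measurable_cost ε hw)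
  have hf1 : ∀ᵐ x ∂μ, ∫⁻ u, f x u ∂q = 1 := by
    filter_upwards [hQ] with x hx
    have : Q x Set.univ = 1 := measure_univ
    rwa [hx, withDensity_apply _ .univ, setLIntegral_univ] at this
  have hfx : ∀ x, Measurable (f x) := fun x => hf.comp measurable_prodMk_left
  set law := poissonLaw (slabIntensity q)
  have hlaw : (μ.prod law).map (fun p => (p.2, select f p)) =
      law ⊗ₘ condDistrib (select f) Prod.snd (μ.prod law) := by
    rw [← compProd_map_condDistrib hsel.aemeasurable]
    congr 1
    exact (measurePreserving_snd (μ := μ) (ν := law)).map_eq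
  have hK : ∀ᵐ p ∂(μ.prod law), select f p = (point p.2 (firstLabel (score (f p.1)) p.2)).2 ∧
      ENNReal.ofReal (Real.exp (-cost ε w (point p.2 (firstLabel (score (f p.1)) p.2)))) ≤
      {z | Active z (firstLabel (score (f p.1)) p.2)}.indicator (fun z => ENNReal.ofReal
        (Real.exp (-cost ε w (point z (firstLabel (score (f p.1)) p.2))))) p.2 := by
    have hmeas : MeasurableSet {p : 𝒳 × (ℕ → ℕ × (ℕ → ℝ × 𝒴)) |
        ∃ a, IsFirst (score (f p.1)) p.2 a} := by
      simp only [Set.ofPred_exists]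
      exact MeasurableSet.iUnion (measurableSet_isFirst_prod (measurable_uncurry_score hf))
    have : ∀ᵐ p ∂(μ.prod law), ∃ a, IsFirst (score (f p.1)) p.2 a := by
      refine (Measure.ae_prod_iff_ae_ae hmeas).2 ?_
      filter_upwards [hf1] with x hx
      exact ae_exists_isFirst q (hfx x) hx
    filter_upwards [this] with p hp
    obtain ⟨a, ha⟩ := hp
    refine ⟨rfl, ?_⟩
    rw [ha.firstLabel_eq, Set.indicator_of_mem (by exact ha.1)]
  have hexp : Measurable fun e : ℝ × 𝒴 => ENNReal.ofReal (Real.exp (-cost ε w e)) :=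
    (Real.measurable_exp.comp hcost.neg).ennreal_ofReal
  refine (lintegral_neg_log_kernel_le (J := ℕ × ℕ) (μ.prod law) law _ measurable_snd hsel hlaw
    (y := fun a z => (point z a).2) (fun a => measurable_snd.comp (measurable_point a))
    (r := fun a => {z | Active z a}.indicator
      fun z => ENNReal.ofReal (Real.exp (-cost ε w (point z a))))
    (fun a => (hexp.comp (measurable_point a)).indicator (measurableSet_active a)) ?_
    (fun p => firstLabel (score (f p.1)) p.2)
    (fun p => cost ε w (point p.2 (firstLabel (score (f p.1)) p.2))) hK).trans ?_
  · simp_rw [lintegral_indicator (measurableSet_active _)]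
    rw [tsum_setLIntegral_active _ hexp, tsum_lintegral_slabIntensity q hexp]
    simp_rw [lintegral_exp_neg_cost hε (hw0 _)]
    exact hw1
  · have hF : Measurable fun p : 𝒳 × 𝒴 => ENNReal.ofReal (Real.log (1 + f p.1 p.2 / w p.2)) := by
      have : Measurable fun p : 𝒳 × 𝒴 => f p.1 p.2 := hf
      fun_prop
    have hcp : Measurable fun p : 𝒳 × (ℕ → ℕ × (ℕ → ℝ × 𝒴)) =>
        ENNReal.ofReal (cost ε w (point p.2 (firstLabel (score (f p.1)) p.2))) :=
      (hcost.comp (measurable_point_firstLabel (measurable_uncurry_score hf))).ennreal_ofReal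
    rw [lintegral_prod _ hcp.aemeasurable, Measure.lintegral_compProd hF]
    calc _ ≤ ∫⁻ x, (ENNReal.ofReal (-Real.log ε) + ENNReal.ofReal (1 + ε) *
          ∫⁻ u, ENNReal.ofReal (Real.log (1 + f x u / w u)) ∂(Q x)) ∂μ := by
          refine lintegral_mono_ae ?_
          filter_upwards [hQ, hf1] with x hx hx1
          refine (lintegral_cost_firstLabel_le q (hfx x) hx1 hw hw0 hε).trans_eq ?_
          have hFx : Measurable fun u => ENNReal.ofReal (Real.log (1 + f x u / w u)) :=
            hF.comp measurable_prodMk_left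
          rw [hx, lintegral_withDensity_eq_lintegral_mul _ (by fun_prop) hFx]
          simp [mul_comm]
      _ = _ := by
          rw [lintegral_add_left measurable_const,
            lintegral_const_mul _ hF.lintegral_kernel_prod_right']
          simp

end

/-! ### The entropy of the selected point -/

section

variable {𝒳 : Type u} [MeasurableSpace 𝒳] {𝒴 : Type v} [MeasurableSpace 𝒴]

/-- The scale of the costs for a source with output marginal `ρ`: the density of the mixture
`(ρ + q) / 2`. It is comparable to the density of `ρ`, and positive everywhere. -/
noncomputable def scale (ρ q : Measure 𝒴) (u : 𝒴) : ℝ≥0 := ((ρ.rnDeriv q u).toNNReal + 1) / 2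

lemma measurable_scale (ρ q : Measure 𝒴) : Measurable (scale ρ q) := by
  have := Measure.measurable_rnDeriv ρ q
  unfold scale; fun_prop

lemma scale_pos (ρ q : Measure 𝒴) (u : 𝒴) : 0 < scale ρ q u := by
  unfold scale; positivity

lemma lintegral_scale_le (ρ q : Measure 𝒴) [IsProbabilityMeasure ρ] [IsProbabilityMeasure q] :
    ∫⁻ u, scale ρ q u ∂q ≤ 1 := by
  have hm := Measure.measurable_rnDeriv ρ q
  calc _ ≤ ∫⁻ u, (ρ.rnDeriv q u + 1) / 2 ∂q := by
        refine lintegral_mono fun u => ?_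
        unfold scale
        rw [ENNReal.coe_div (by norm_num)]
        push_cast
        gcongr
        exact ENNReal.coe_toNNReal_le_self
    _ = (∫⁻ u, ρ.rnDeriv q u ∂q + 1) / 2 := by
        simp_rw [div_eq_mul_inv]
        rw [lintegral_mul_const _ (by fun_prop), lintegral_add_right _ measurable_const]
        simp
    _ ≤ 1 := by
        refine ENNReal.div_le_of_le_mul ?_
        have : ∫⁻ u, ρ.rnDeriv q u ∂q ≤ 1 := by
          simpa using Measure.lintegral_rnDeriv_le (μ := ρ) (ν := q)
        calc _ ≤ (1 : ℝ≥0∞) + 1 := by gcongr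
          _ = 1 * 2 := by norm_num

/-- The expected log-likelihood ratio in the entropy bound is controlled by the information. -/
lemma lintegral_log_density_le (μ : Measure 𝒳) [IsProbabilityMeasure μ] (q : Measure 𝒴)
    [IsProbabilityMeasure q] (Q : Kernel 𝒳 𝒴) [IsMarkovKernel Q] {f : 𝒳 → 𝒴 → ℝ≥0}
    (hf : Measurable (Function.uncurry f)) (hf1 : ∀ x, ∫⁻ u, f x u ∂q ≤ 1)
    (hq : (μ ⊗ₘ Q).snd ≪ q)
    (hkl : InformationTheory.klDiv (μ ⊗ₘ Q) (μ.prod (μ ⊗ₘ Q).snd) ≠ ∞) :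
    ∫⁻ p, ENNReal.ofReal (Real.log (1 + f p.1 p.2 / scale (μ ⊗ₘ Q).snd q p.2)) ∂(μ ⊗ₘ Q) ≤
      ENNReal.ofReal ((InformationTheory.klDiv (μ ⊗ₘ Q) (μ.prod (μ ⊗ₘ Q).snd)).toReal +
        Real.log 3) := by
  set ρ := (μ ⊗ₘ Q).snd
  have hfm : Measurable fun p : 𝒳 × 𝒴 => f p.1 p.2 := hf
  have hw := measurable_scale ρ q
  have hF : Measurable fun p : 𝒳 × 𝒴 => f p.1 p.2 / scale ρ q p.2 := by fun_prop
  have h := lintegral_log_one_add_le_klDiv (μ ⊗ₘ Q) (μ.prod ρ) hkl hF ?_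
  · simpa using h
  have hFe : Measurable fun p : 𝒳 × 𝒴 => ((f p.1 p.2 / scale ρ q p.2 : ℝ≥0) : ℝ≥0∞) := by fun_prop
  rw [lintegral_prod _ hFe.aemeasurable]
  calc _ ≤ ∫⁻ x, 2 ∂μ := by
        refine lintegral_mono fun x => ?_
        have hFx : Measurable fun u => ((f x u / scale ρ q u : ℝ≥0) : ℝ≥0∞) :=
          hFe.comp measurable_prodMk_left
        have hfx : Measurable (f x) := hfm.comp measurable_prodMk_left
        dsimp only
        rw [← lintegral_rnDeriv_mul hq hFx.aemeasurable]
        calc _ ≤ ∫⁻ u, 2 * (f x u : ℝ≥0∞) ∂q := by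
              refine lintegral_mono_ae ?_
              filter_upwards [Measure.rnDeriv_lt_top ρ q] with u hu
              rw [← ENNReal.coe_toNNReal hu.ne]
              norm_cast
              unfold scale
              set a := (ρ.rnDeriv q u).toNNReal
              rw [mul_div_assoc', div_le_iff₀ (by positivity)]
              calc a * f x u ≤ (a + 1) * f x u := by gcongr; simp
                _ = 2 * f x u * ((a + 1) / 2) := by field_simp
          _ ≤ 2 * 1 := by
              rw [lintegral_const_mul _ (by fun_prop)]
              gcongr
              exact hf1 x
          _ = 2 := mul_one _
    _ = 2 := by simp

lemma condKernel_congr {α Ω : Type*} [MeasurableSpace α] [MeasurableSpace Ω] [StandardBorelSpace Ω]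
    [Nonempty Ω] {ρ ρ' : Measure (α × Ω)} [IsFiniteMeasure ρ] [IsFiniteMeasure ρ'] (h : ρ = ρ') :
    ρ.condKernel = ρ'.condKernel := by
  subst h; rfl

/-- The conditional entropy depends on the joint law only. -/
lemma condEntropy_congr {Ω : Type*} {Ω' : Type*} {𝒵 : Type*} [MeasurableSpace Ω]
    [MeasurableSpace Ω'] [MeasurableSpace 𝒵] [StandardBorelSpace 𝒴] [Nonempty 𝒴]
    (P : Measure Ω) [IsFiniteMeasure P] (P' : Measure Ω') [IsFiniteMeasure P']
    {Y : Ω → 𝒴} {Z : Ω → 𝒵} {Y' : Ω' → 𝒴} {Z' : Ω' → 𝒵} (hY : Measurable Y) (hY' : Measurable Y')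
    (hlaw : P.map (fun ω => (Z ω, Y ω)) = P'.map (fun ω => (Z' ω, Y' ω))) :
    condEntropy P Y Z = condEntropy P' Y' Z' := by
  have h1 : condDistrib Y Z P = condDistrib Y' Z' P' := by
    rw [condDistrib, condDistrib]
    exact condKernel_congr hlaw
  have h2 : P.map Z = P'.map Z' := by
    rw [← Measure.fst_map_prodMk hY, hlaw, Measure.fst_map_prodMk hY']
  unfold condEntropy
  rw [h1, h2]

lemma condEntropy_eq_div {Ω : Type*} {𝒵 : Type*} [MeasurableSpace Ω]
    [MeasurableSpace 𝒵] [StandardBorelSpace 𝒴] [Nonempty 𝒴]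
    (P : Measure Ω) [IsFiniteMeasure P] (Y : Ω → 𝒴) (Z : Ω → 𝒵) :
    condEntropy P Y Z = (∫⁻ z, ∫⁻ y, (-(ENNReal.log (condDistrib Y Z P z {y}))).toENNReal
      ∂(condDistrib Y Z P z) ∂(P.map Z)) / ENNReal.ofReal (Real.log 2) := by
  unfold condEntropy entropy
  simp_rw [div_eq_mul_inv]
  rw [lintegral_mul_const' _ _ (ENNReal.inv_ne_top.2 (by simp [Real.log_pos one_lt_two]))]

/-- The entropy bound in bits, with `ε = 1 / (I + 1)`. -/
lemma entropy_bound_le {I K c : ℝ} (hI : 0 ≤ I) (hK : K ≤ I * Real.log 2) (hc : 1 ≤ c) :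
    (-Real.log (1 / (I + 1)) + (1 + 1 / (I + 1)) * (K + Real.log 3)) / Real.log 2 ≤
      I + Real.logb 2 (c * (I + 1)) + 4 := by
  have h2 : 0 < Real.log 2 := Real.log_pos one_lt_two
  have h23 : Real.log 2 ≤ Real.log 3 := Real.log_le_log (by norm_num) (by norm_num)
  have h3 : 2 * Real.log 3 ≤ 4 * Real.log 2 := by
    have : Real.log (3 ^ 2) ≤ Real.log (2 ^ 4) := Real.log_le_log (by norm_num) (by norm_num)
    rw [Real.log_pow, Real.log_pow] at this
    exact_mod_cast this
  have hlogc : 0 ≤ Real.log c := Real.log_nonneg hc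
  rw [div_le_iff₀ h2, Real.logb, Real.log_mul (by positivity) (by positivity), one_div,
    Real.log_inv]
  have hcancel : (Real.log c + Real.log (I + 1)) / Real.log 2 * Real.log 2 =
      Real.log c + Real.log (I + 1) := by field_simp
  have hprod : (I + 1)⁻¹ * (K + Real.log 3) ≤ Real.log 3 := by
    rw [inv_mul_le_iff₀ (by positivity)]
    nlinarith
  nlinarith

/-- The bound on `H(Y | Z)` for one source; `c` is the number of sources, whose logarithm is not
needed. -/
theorem condEntropy_select_le [StandardBorelSpace 𝒴] [Nonempty 𝒴]
    (μ : ProbabilityMeasure 𝒳) (q : Measure 𝒴) [IsProbabilityMeasure q] (Q : Kernel 𝒳 𝒴)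
    [IsMarkovKernel Q] {f : 𝒳 → 𝒴 → ℝ≥0} (hf : Measurable (Function.uncurry f))
    (hf1 : ∀ x, ∫⁻ u, f x u ∂q ≤ 1)
    (hQ : ∀ᵐ x ∂(μ : Measure 𝒳), Q x = q.withDensity fun u => f x u)
    (hq : ((μ : Measure 𝒳) ⊗ₘ Q).snd ≪ q) {I c : ℝ} (hI : 0 ≤ I) (hc : 1 ≤ c)
    (hμ : mutualInfo μ Q ≤ ENNReal.ofReal I) :
    condEntropy ((μ : Measure 𝒳).prod (poissonLaw (slabIntensity q))) (select f) Prod.snd ≤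
      ENNReal.ofReal (I + Real.logb 2 (c * (I + 1)) + 4) := by
  have h2 : 0 < Real.log 2 := Real.log_pos one_lt_two
  unfold mutualInfo at hμ
  have hkl' : InformationTheory.klDiv ((μ : Measure 𝒳) ⊗ₘ Q)
      ((μ : Measure 𝒳).prod ((μ : Measure 𝒳) ⊗ₘ Q).snd) ≤ ENNReal.ofReal (I * Real.log 2) := by
    rw [ENNReal.ofReal_mul hI]
    exact (ENNReal.div_le_iff (by simp [h2]) ENNReal.ofReal_ne_top).1 hμ
  have hkl := (hkl'.trans_lt ENNReal.ofReal_lt_top).ne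
  have hK := ENNReal.toReal_le_of_le_ofReal (by positivity) hkl'
  have hε : 0 < 1 / (I + 1) := by positivity
  have hbound := (lintegral_neg_log_select_le q Q hf (μ : Measure 𝒳) hQ (measurable_scale _ q)
    (scale_pos _ q) (lintegral_scale_le ((μ : Measure 𝒳) ⊗ₘ Q).snd q) hε).trans
    (add_le_add_right (mul_le_mul_right
      (lintegral_log_density_le (μ : Measure 𝒳) q Q hf hf1 hq hkl) _) _)
  have hlogε : 0 ≤ -Real.log (1 / (I + 1)) := by
    rw [one_div, Real.log_inv, neg_neg]
    exact Real.log_nonneg (by linarith)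
  have hlog3 : 0 ≤ Real.log 3 := Real.log_nonneg (by norm_num)
  rw [← ENNReal.ofReal_mul (by positivity), ← ENNReal.ofReal_add hlogε (by positivity)] at hbound
  rw [condEntropy_eq_div, (measurePreserving_snd (μ := (μ : Measure 𝒳))
    (ν := poissonLaw (slabIntensity q))).map_eq]
  refine (ENNReal.div_le_div_right hbound _).trans ?_
  rw [← ENNReal.ofReal_div_of_pos h2]
  exact ENNReal.ofReal_le_ofReal (entropy_bound_le hI hK hc)

end

/-! ### Copies of the representation on other probability spaces -/

section

variable {𝒳 : Type u} [MeasurableSpace 𝒳] {𝒴 : Type v} [MeasurableSpace 𝒴]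

lemma map_comp_congr {Ω Ω₀ α β : Type*} [MeasurableSpace Ω] [MeasurableSpace Ω₀]
    [MeasurableSpace α] [MeasurableSpace β] {P : Measure Ω} {M : Measure Ω₀} {T : Ω → α}
    {T₀ : Ω₀ → α} (hT : Measurable T) (hT₀ : Measurable T₀) (h : P.map T = M.map T₀)
    {φ : α → β} (hφ : Measurable φ) :
    P.map (fun ω => φ (T ω)) = M.map fun ω => φ (T₀ ω) := by
  have := congrArg (Measure.map φ) h
  rwa [Measure.map_map hφ hT, Measure.map_map hφ hT₀] at this

/-- The representation of a triple `(X, Y, Z)` with the same law as `(x, g (x, z), z)` under a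
product measure `μ × ν`. -/
lemma represents_of_map_eq {Ω : Type*} {𝒵 : Type*} [MeasurableSpace Ω] [MeasurableSpace 𝒵]
    [StandardBorelSpace 𝒴] [Nonempty 𝒴] {P : Measure Ω} [IsProbabilityMeasure P]
    {μ : Measure 𝒳} [IsProbabilityMeasure μ] {ν : Measure 𝒵} [IsProbabilityMeasure ν]
    {g : 𝒳 × 𝒵 → 𝒴} (hg : Measurable g) {X : Ω → 𝒳} {Y : Ω → 𝒴} {Z : Ω → 𝒵} (hX : Measurable X)
    (hY : Measurable Y) (hZ : Measurable Z)
    (hlaw : P.map (fun ω => ((X ω, Y ω), Z ω)) = (μ.prod ν).map fun p => ((p.1, g p), p.2)) :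
    P.map Z = ν ∧ IndepFun X Z P ∧ (∀ᵐ ω ∂P, Y ω = g (X ω, Z ω)) ∧
      condEntropy P Y Z = condEntropy (μ.prod ν) g Prod.snd := by
  have hT : Measurable fun ω => ((X ω, Y ω), Z ω) := (hX.prodMk hY).prodMk hZ
  have hT' : Measurable fun p : 𝒳 × 𝒵 => ((p.1, g p), p.2) :=
    (measurable_fst.prodMk hg).prodMk measurable_snd
  have hXZ : P.map (fun ω => (X ω, Z ω)) = μ.prod ν := by
    have := map_comp_congr hT hT' hlaw (φ := fun t => (t.1.1, t.2)) (by fun_prop)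
    simpa using this
  have hPX : P.map X = μ := by
    rw [← Measure.fst_map_prodMk hZ, hXZ, Measure.fst_prod]
  have hPZ : P.map Z = ν := by
    rw [← Measure.snd_map_prodMk hX, hXZ, Measure.snd_prod]
  refine ⟨hPZ, ?_, ?_, ?_⟩
  · rw [indepFun_iff_map_prod_eq_prod_map_map hX.aemeasurable hZ.aemeasurable, hXZ, hPX, hPZ]
  · have hD : MeasurableSet {t : (𝒳 × 𝒴) × 𝒵 | t.1.2 = g (t.1.1, t.2)} :=
      measurableSet_eq_fun (by fun_prop) (hg.comp (by fun_prop))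
    have h1 : ∀ᵐ t ∂(P.map fun ω => ((X ω, Y ω), Z ω)), t.1.2 = g (t.1.1, t.2) := by
      rw [hlaw, ae_map_iff hT'.aemeasurable hD]
      exact ae_of_all _ fun p => rfl
    exact (ae_map_iff hT.aemeasurable hD).1 h1
  · exact condEntropy_congr P (μ.prod ν) hY hg
      (map_comp_congr hT hT' hlaw (φ := fun t => (t.2, t.1.2)) (by fun_prop))

/-- A probability measure that dominates finitely many given ones. -/
lemma exists_dominating [Nonempty 𝒴] {ι : Type*} (s : Finset ι) (ρ : ι → Measure 𝒴)
    [∀ i, IsFiniteMeasure (ρ i)] :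
    ∃ q : Measure 𝒴, IsProbabilityMeasure q ∧ ∀ i ∈ s, ρ i ≪ q := by
  let y₀ : 𝒴 := Classical.arbitrary 𝒴
  -- the Dirac mass serves the case of an empty family
  set m : Measure 𝒴 := Measure.dirac y₀ + ∑ i ∈ s, ρ i
  have hne : NeZero m := ⟨fun h => by
    have := congrArg (fun κ : Measure 𝒴 => κ Set.univ) h
    simp [m] at this⟩
  refine ⟨m.toFinite, inferInstance, fun i hi => ?_⟩
  refine Measure.AbsolutelyContinuous.trans ?_ (absolutelyContinuous_toFinite m)
  refine Measure.absolutelyContinuous_of_le ?_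
  refine (Measure.le_iff.2 fun t _ => ?_ : ρ i ≤ ∑ i ∈ s, ρ i).trans (Measure.le_add_left le_rfl)
  rw [Measure.finsetSum_apply]
  exact Finset.single_le_sum (f := fun i => ρ i t) (fun _ _ => zero_le) hi

/-- Given a law `M.map T` of triples, a pair on another space with the law of the first two
components extends to a triple, on a product space. -/
lemma map_compProd_condDistrib {Ω : Type*} {Ω₀ α 𝒵 : Type*} [MeasurableSpace Ω]
    [MeasurableSpace Ω₀] [MeasurableSpace α] [MeasurableSpace 𝒵] [StandardBorelSpace 𝒵]
    [Nonempty 𝒵] (P : Measure Ω) [IsProbabilityMeasure P] (M : Measure Ω₀) [IsProbabilityMeasure M]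
    {V : Ω → α} (hV : Measurable V) {V₀ : Ω₀ → α} {Z₀ : Ω₀ → 𝒵}
    (hZ₀ : Measurable Z₀) (hlaw : P.map V = M.map V₀) :
    (P ⊗ₘ (condDistrib Z₀ V₀ M).comap V hV).map (fun ω => (V ω.1, ω.2)) =
      M.map fun ω => (V₀ ω, Z₀ ω) := by
  rw [← compProd_map_condDistrib hZ₀.aemeasurable, ← hlaw]
  refine Measure.ext_of_lintegral _ fun h hh => ?_
  have hm : Measurable fun ω : Ω × 𝒵 => h (V ω.1, ω.2) := hh.comp (by fun_prop)
  rw [lintegral_map hh (by fun_prop), Measure.lintegral_compProd hm, Measure.lintegral_compProd hh,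
    lintegral_map (Measurable.lintegral_kernel_prod_right' hh) hV]
  simp

end

end RobustSFRL

theorem mainTheorem2
    {𝒳 : Type u} [TopologicalSpace 𝒳] [PolishSpace 𝒳] [MeasurableSpace 𝒳] [BorelSpace 𝒳]
    {𝒴 : Type v} [TopologicalSpace 𝒴] [PolishSpace 𝒴] [MeasurableSpace 𝒴] [BorelSpace 𝒴]
    [Nonempty 𝒴]
    (S : Finset (ProbabilityMeasure 𝒳)) (Q : Kernel 𝒳 𝒴) [IsMarkovKernel Q]
    (hI : ∀ μ ∈ S, RobustSFRL.mutualInfo μ Q < ∞)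
    (I : ℝ) (hIbar : I = (RobustSFRL.maxMutualInfo S Q).toReal) :
    -- the alphabet and the law of `Z`, and the function `g`, common to all sources in `S`
    ∃ (𝒵 : Type v) (_ : MeasurableSpace 𝒵) (_ : StandardBorelSpace 𝒵)
      (PZ : ProbabilityMeasure 𝒵) (g : 𝒳 × 𝒵 → 𝒴),
      Measurable g ∧
      -- one probability space that carries a single `Z` and a pair `(X_μ, Y_μ)` for every `μ ∈ S`
      (∃ (Ω : Type (max u v)) (_ : MeasurableSpace Ω) (P : Measure Ω) (_ : IsProbabilityMeasure P)
        (Z : Ω → 𝒵) (X : S → Ω → 𝒳) (Y : S → Ω → 𝒴),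
        Measurable Z ∧ P.map Z = PZ ∧
        ∀ μ : S, Measurable (X μ) ∧ Measurable (Y μ) ∧
          P.map (fun ω => (X μ ω, Y μ ω)) = (μ.1 : Measure 𝒳) ⊗ₘ Q ∧
          IndepFun (X μ) Z P ∧
          (∀ᵐ ω ∂P, Y μ ω = g (X μ ω, Z ω)) ∧
          RobustSFRL.condEntropy P (Y μ) Z ≤
            ENNReal.ofReal (I + Real.logb 2 ((S.card : ℝ) * (I + 1)) + 4)) ∧
      -- every given pair `(X, Y) ∼ μ ⊗ Q`, on any probability space, is represented in this way by
      -- a copy of `Z` on an extension of that space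
      (∀ μ ∈ S, ∀ (Ω : Type w) [MeasurableSpace Ω] (P : Measure Ω) [IsProbabilityMeasure P]
        (X : Ω → 𝒳) (Y : Ω → 𝒴), Measurable X → Measurable Y →
        P.map (fun ω => (X ω, Y ω)) = (μ : Measure 𝒳) ⊗ₘ Q →
        ∃ (Ω' : Type (max v w)) (_ : MeasurableSpace Ω') (P' : Measure Ω')
          (_ : IsProbabilityMeasure P') (π : Ω' → Ω) (Z : Ω' → 𝒵),
          MeasurePreserving π P' P ∧ Measurable Z ∧ P'.map Z = PZ ∧
          IndepFun (fun ω => X (π ω)) Z P' ∧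
          (∀ᵐ ω ∂P', Y (π ω) = g (X (π ω), Z ω)) ∧
          RobustSFRL.condEntropy P' (fun ω => Y (π ω)) Z ≤
            ENNReal.ofReal (I + Real.logb 2 ((S.card : ℝ) * (I + 1)) + 4)) := by
  open RobustSFRL in
  obtain ⟨q, hqp, hq⟩ := exists_dominating S fun μ : ProbabilityMeasure 𝒳 =>
    ((μ : Measure 𝒳) ⊗ₘ Q).snd
  -- a jointly measurable density of `Q x` with respect to `q`
  set d := Q.rnDeriv (Kernel.const 𝒳 q)
  set f : 𝒳 → 𝒴 → NNReal := fun x u => (d x u).toNNReal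
  have hd : Measurable fun p : 𝒳 × 𝒴 => d p.1 p.2 := Kernel.measurable_rnDeriv _ _
  have hf : Measurable (Function.uncurry f) := hd.ennreal_toNNReal
  have hf1 : ∀ x, ∫⁻ u, f x u ∂q ≤ 1 := fun x =>
    calc _ ≤ ∫⁻ u, d x u ∂q := lintegral_mono fun u => ENNReal.coe_toNNReal_le_self
      _ ≤ 1 := by
        have := Kernel.setLIntegral_rnDeriv_le (κ := Q) (η := Kernel.const 𝒳 q) (a := x)
          MeasurableSet.univ
        simpa using this
  have hdens : ∀ x, Q x ≪ q → Q x = q.withDensity fun u => f x u := by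
    intro x hx
    have h1 : Q x ≪ Kernel.const 𝒳 q x := by simpa using hx
    have h2 := Kernel.withDensity_rnDeriv_eq h1
    rw [Kernel.withDensity_apply _ (Kernel.measurable_rnDeriv _ _), Kernel.const_apply] at h2
    rw [← h2]
    refine withDensity_congr_ae ?_
    have h3 : ∀ᵐ u ∂(Kernel.const 𝒳 q x), d x u ≠ ∞ := Kernel.rnDeriv_ne_top _ _
    rw [Kernel.const_apply] at h3
    filter_upwards [h3] with u hu
    exact (ENNReal.coe_toNNReal hu).symm
  have hQ : ∀ μ ∈ S, ∀ᵐ x ∂(μ : Measure 𝒳), Q x = q.withDensity fun u => f x u := by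
    intro μ hμ
    have hkl : InformationTheory.klDiv ((μ : Measure 𝒳) ⊗ₘ Q)
        ((μ : Measure 𝒳).prod ((μ : Measure 𝒳) ⊗ₘ Q).snd) ≠ ∞ := by
      intro h
      have := hI μ hμ
      unfold mutualInfo at this
      rw [h, ENNReal.top_div_of_ne_top ENNReal.ofReal_ne_top] at this
      exact lt_irrefl _ this
    have hac := (InformationTheory.klDiv_ne_top_iff.1 hkl).1
    rw [← Measure.compProd_const] at hac
    filter_upwards [hac.kernel_of_compProd] with x hx
    rw [Kernel.const_apply] at hx
    exact hdens x (hx.trans (hq μ hμ))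
  have hI0 : 0 ≤ I := hIbar ▸ ENNReal.toReal_nonneg
  have hbound : ∀ μ ∈ S, condEntropy ((μ : Measure 𝒳).prod (poissonLaw (slabIntensity q)))
      (select f) Prod.snd ≤ ENNReal.ofReal (I + Real.logb 2 ((S.card : ℝ) * (I + 1)) + 4) := by
    intro μ hμ
    refine condEntropy_select_le μ q Q hf hf1 (hQ μ hμ) (hq μ hμ) hI0 ?_ ?_
    · exact_mod_cast Finset.card_pos.2 ⟨μ, hμ⟩
    · have htop : maxMutualInfo S Q ≠ ∞ := by
        unfold maxMutualInfo
        rw [← Finset.sup_eq_iSup]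
        exact ((Finset.sup_lt_iff ENNReal.zero_lt_top).2 hI).ne
      rw [hIbar, ENNReal.ofReal_toReal htop]
      exact le_iSup₂_of_le μ hμ le_rfl
  have hg := measurable_select hf
  refine ⟨ℕ → ℕ × (ℕ → ℝ × 𝒴), inferInstance, inferInstance,
    ⟨poissonLaw (slabIntensity q), inferInstance⟩, select f, hg, ?_, ?_⟩
  · have hZ : Measurable fun ω : (S → 𝒳) × (ℕ → ℕ × (ℕ → ℝ × 𝒴)) => ω.2 := measurable_snd
    refine ⟨(S → 𝒳) × (ℕ → ℕ × (ℕ → ℝ × 𝒴)), inferInstance,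
      (Measure.pi fun μ : S => (μ.1 : Measure 𝒳)).prod (poissonLaw (slabIntensity q)),
      inferInstance, fun ω => ω.2, fun μ ω => ω.1 μ, fun μ ω => select f (ω.1 μ, ω.2), hZ,
      measurePreserving_snd.map_eq, fun μ => ?_⟩
    have hX : Measurable fun ω : (S → 𝒳) × (ℕ → ℕ × (ℕ → ℝ × 𝒴)) => ω.1 μ := by fun_prop
    have hY : Measurable fun ω : (S → 𝒳) × (ℕ → ℕ × (ℕ → ℝ × 𝒴)) => select f (ω.1 μ, ω.2) :=
      hg.comp (hX.prodMk hZ)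
    have hXZ : MeasurePreserving
        (fun ω : (S → 𝒳) × (ℕ → ℕ × (ℕ → ℝ × 𝒴)) => (ω.1 μ, ω.2))
        ((Measure.pi fun μ : S => (μ.1 : Measure 𝒳)).prod (poissonLaw (slabIntensity q)))
        ((μ.1 : Measure 𝒳).prod (poissonLaw (slabIntensity q))) :=
      (measurePreserving_eval (fun μ : S => (μ.1 : Measure 𝒳)) μ).prod (MeasurePreserving.id _)
    have hlaw := hXZ.map_eq
    obtain ⟨-, h1, h2, h3⟩ := represents_of_map_eq hg hX hY hZ (by
      rw [← hlaw, Measure.map_map ((measurable_fst.prodMk hg).prodMk measurable_snd)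
        hXZ.measurable]
      rfl)
    refine ⟨hX, hY, ?_, h1, h2, h3.trans_le (hbound μ.1 μ.2)⟩
    rw [← map_select q Q hf (μ.1 : Measure 𝒳) (hQ μ.1 μ.2), ← hlaw,
      Measure.map_map (measurable_fst.prodMk hg) hXZ.measurable]
    rfl
  · intro μ hμ Ω _ P _ X Y hX hY hXY
    have hV : Measurable fun ω => (X ω, Y ω) := hX.prodMk hY
    set M := (μ : Measure 𝒳).prod (poissonLaw (slabIntensity q))
    -- the conditional law of the process given the pair that it produces
    set κ := (condDistrib Prod.snd (fun p => (p.1, select f p)) M).comap _ hV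
    have hX' : Measurable fun ω : Ω × (ℕ → ℕ × (ℕ → ℝ × 𝒴)) => X ω.1 := hX.comp measurable_fst
    have hY' : Measurable fun ω : Ω × (ℕ → ℕ × (ℕ → ℝ × 𝒴)) => Y ω.1 := hY.comp measurable_fst
    have hlaw := map_compProd_condDistrib P M hV (V₀ := fun p => (p.1, select f p)) measurable_snd
      (hXY.trans (map_select q Q hf (μ : Measure 𝒳) (hQ μ hμ)).symm)
    obtain ⟨h0, h1, h2, h3⟩ := represents_of_map_eq hg hX' hY' measurable_snd hlaw
    exact ⟨Ω × (ℕ → ℕ × (ℕ → ℝ × 𝒴)), inferInstance, P ⊗ₘ κ, inferInstance, Prod.fst, Prod.snd,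
      ⟨measurable_fst, Measure.fst_compProd P κ⟩, measurable_snd, h0, h1, h2,
      h3.trans_le (hbound μ hμ)⟩
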